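/- Let $\Sigma$ be a closed connected oriented surface of genus $\mathtt g\ge 2$ and let $\mathcal T$ be a triangulation of $\Sigma$ (loops and parallel edges are allowed, every vertex has valence at least $3$, every face is a disk bounded by three edges) that is quasi-simplicial, i.e. its lift $\widetilde{\mathcal T}$ to the universal covering $\widetilde\Sigma$ has neither loops nor parallel edges. Let $\mathrm{dS}^3$ be the set of Hermitian $2\times2$ matrices $X$ with $\det X=-1$, let $\langle\cdot,\cdot\rangle$ be the polarization of $-\det$ on Hermitian matrices, and for $X\in\mathrm{dS}^3$ let $\Delta(X)=\{[z_0:z_1]\in\mathbb{CP}^1 \mid \sum X_{ij}z_i\bar z_j<0\}$ be the corresponding open round disk. The group $PSL(2,\mathbb C)$ acts on Hermitian matrices by $B\cdot X=(B^{-1})^TX\overline{B^{-1}}$, so that $\Delta(B\cdot X)=B(\Delta(X))$. Let $(\rho,S)$ be a point of the packing locus of $\mathcal T$, i.e. the holonomy and the selection map of a circle packing with nerve $\mathcal T$ on a projective structure on $\Sigma$. Explicitly: $\rho:\pi_1(\Sigma)\to PSL(2,\mathbb C)$ is a non-elementary representation; $S$ is a $\rho$-equivariant map from the vertices of $\widetilde{\mathcal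 T}$ to $\mathrm{dS}^3$; for any two vertices $\alpha,\beta$ joined by an edge $\epsilon$ of $\widetilde{\mathcal T}$, $\langle S(\alpha),S(\beta)\rangle=-1$ and $S(\alpha)+S(\beta)$ is not negative semidefinite, so that $\Delta(S(\alpha))$ and $\Delta(S(\beta))$ are tangent, at a point $p(\epsilon)$; and for each vertex $\alpha$ of $\widetilde{\mathcal T}$, if $\epsilon_1,\dots,\epsilon_k$ are the edges at $\alpha$ in counterclockwise cyclic order, then the points $p(\epsilon_1),\dots,p(\epsilon_k)$ follow each other counterclockwise in this cyclic order, going exactly once around the circle $\partial\Delta(S(\alpha))$. For $A\in\mathfrak{sl}(2,\mathbb C)$ let $v_A$ be the projective vector field $v_A(p)=\frac{d}{dt}\big|_{t=0}\exp(tA)\cdot p$ on $\mathbb{CP}^1$. Let $P$ be a map from the vertices of $\widetilde{\mathcal T}$ to $\mathfrak{sl}(2,\mathbb C)$ with $P(\gamma\alpha)=\mathrm{Ad}(\rho(\gamma))P(\alpha)$ for all $\gamma\in\pi_1(\Sigma)$ and all vertices $\alpha$. If for every oriented edge $\varepsilon$ of $\widetilde{\mathcal T}$ with endpoints $\varepsilon_-,\varepsilon_+$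 $$v_{P(\varepsilon_+)}(p(\varepsilon))=v_{P(\varepsilon_-)}(p(\varepsilon)),$$ then $P=0$. -/

import Mathlib

open scoped MatrixGroups LinearAlgebra.Projectivization Matrix ComplexOrder

/-! ### Triangulated closed oriented surfaces -/

/-- A (possibly non-simplicial: loops and parallel edges are allowed) triangulation of a connected
closed oriented surface, up to isotopy, as a rotation system on the set `D` of oriented edges.
`rev` reverses an oriented edge; `σ d` is the oriented edge that follows `d` in the counterclockwise
cyclic order on the oriented edges with the same initial vertex. The oriented edge that follows
`d` in the boundary of the face on the left of `d` is then `σ⁻¹ (rev d)`. -/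
structure OrientedTriangulation (D : Type*) where
  σ : Equiv.Perm D
  rev : Equiv.Perm D
  rev_rev : ∀ d, rev (rev d) = d
  rev_ne : ∀ d, rev d ≠ d
  /-- Every face is bounded by exactly three edges. -/
  face_three : ∀ d, σ⁻¹ (rev (σ⁻¹ (rev (σ⁻¹ (rev d))))) = d
  face_ne : ∀ d, σ⁻¹ (rev d) ≠ d
  /-- Every vertex has valence at least three. -/
  valence_ne_one : ∀ d, σ d ≠ d
  valence_ne_two : ∀ d, σ (σ d) ≠ d
  /-- The surface is connected. -/
  connected : ∀ d d', ∃ g ∈ Subgroup.closure {σ, rev}, g d = d'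

namespace OrientedTriangulation

variable {D : Type*} (T : OrientedTriangulation D)

/-- The next oriented edge in the boundary of the face on the left. -/
def nxt : Equiv.Perm D := T.σ⁻¹ * T.rev

/-- Vertices, edges and faces are the cycles of `σ`, `rev` and `nxt`. -/
abbrev Vert : Type _ := Quotient (Equiv.Perm.SameCycle.setoid T.σ)

abbrev Edge : Type _ := Quotient (Equiv.Perm.SameCycle.setoid T.rev)

abbrev Face : Type _ := Quotient (Equiv.Perm.SameCycle.setoid T.nxt)

/-- The Euler characteristic `v - e + f`. -/
noncomputable def eulerChar : ℤ := Nat.card T.Vert - Nat.card T.Edge + Nat.card T.Face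

/-- The initial vertex of an oriented edge. -/
def src (d : D) : T.Vert := Quotient.mk _ d

/-- The terminal vertex of an oriented edge. -/
def tgt (d : D) : T.Vert := T.src (T.rev d)

theorem src_σ (d : D) : T.src (T.σ d) = T.src d :=
  Quotient.sound (Equiv.Perm.SameCycle.symm ⟨1, by simp⟩)

theorem tgt_rev (d : D) : T.tgt (T.rev d) = T.src d := by
  simp [tgt, T.rev_rev]

/-! ### Homotopy classes of edge paths, fundamental group, universal covering -/

/-- The list `l` of oriented edges is an edge path from `v` to `w`. -/
def IsWalk : T.Vert → List D → T.Vert → Prop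
  | v, [], w => v = w
  | v, d :: l, w => T.src d = v ∧ IsWalk (T.tgt d) l w

/-- Elementary homotopies: deleting a backtrack, or the boundary of a face (run through in
either direction). -/
inductive HomotopyStep : List D → List D → Prop
  | backtrack (l m : List D) (d : D) : HomotopyStep (l ++ d :: T.rev d :: m) (l ++ m)
  | face (l m : List D) (d : D) :
      HomotopyStep (l ++ d :: T.nxt d :: T.nxt (T.nxt d) :: m) (l ++ m)
  | faceRev (l m : List D) (d : D) :
      HomotopyStep (l ++ T.rev (T.nxt (T.nxt d)) :: T.rev (T.nxt d) :: T.rev d :: m) (l ++ m)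

/-- Homotopy classes, relative to the endpoints, of edge paths from `v` to `w`. -/
def PathClass (v w : T.Vert) : Type _ :=
  Quot fun p q : {l : List D // T.IsWalk v l w} => T.HomotopyStep p.1 q.1

variable {T}

theorem IsWalk.append {u v w : T.Vert} {l m : List D} (hl : T.IsWalk u l v)
    (hm : T.IsWalk v m w) : T.IsWalk u (l ++ m) w := by
  induction l generalizing u with
  | nil => cases hl; exact hm
  | cons d l ih => exact ⟨hl.1, ih hl.2⟩

theorem IsWalk.reverse {u v : T.Vert} {l : List D} (hl : T.IsWalk u l v) :
    T.IsWalk v (l.map T.rev).reverse u := by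
  induction l generalizing u with
  | nil => exact Eq.symm hl
  | cons d l ih =>
    simp only [List.map_cons, List.reverse_cons]
    exact (ih hl.2).append ⟨rfl, (T.tgt_rev d).trans hl.1⟩

theorem HomotopyStep.append_left {l m : List D} (h : T.HomotopyStep l m) (k : List D) :
    T.HomotopyStep (k ++ l) (k ++ m) := by
  cases h with
  | backtrack a b d => simpa using HomotopyStep.backtrack (T := T) (k ++ a) b d
  | face a b d => simpa using HomotopyStep.face (T := T) (k ++ a) b d
  | faceRev a b d => simpa using HomotopyStep.faceRev (T := T) (k ++ a) b d

theorem HomotopyStep.append_right {l m : List D} (h : T.HomotopyStep l m) (k : List D) :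
    T.HomotopyStep (l ++ k) (m ++ k) := by
  cases h with
  | backtrack a b d => simpa using HomotopyStep.backtrack (T := T) a (b ++ k) d
  | face a b d => simpa using HomotopyStep.face (T := T) a (b ++ k) d
  | faceRev a b d => simpa using HomotopyStep.faceRev (T := T) a (b ++ k) d

theorem HomotopyStep.reverse {l m : List D} (h : T.HomotopyStep l m) :
    T.HomotopyStep (l.map T.rev).reverse (m.map T.rev).reverse := by
  cases h with
  | backtrack a b d =>
    simpa [T.rev_rev] using
      HomotopyStep.backtrack (T := T) (b.map T.rev).reverse (a.map T.rev).reverse d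
  | face a b d =>
    simpa using HomotopyStep.faceRev (T := T) (b.map T.rev).reverse (a.map T.rev).reverse d
  | faceRev a b d =>
    simpa [T.rev_rev] using
      HomotopyStep.face (T := T) (b.map T.rev).reverse (a.map T.rev).reverse d

namespace PathClass

/-- The class of the constant path. -/
def nil (v : T.Vert) : T.PathClass v v := Quot.mk _ ⟨[], rfl⟩

/-- The class of a single oriented edge. -/
def single (d : D) {v : T.Vert} (h : T.src d = v) : T.PathClass v (T.tgt d) :=
  Quot.mk _ ⟨[d], h, rfl⟩

/-- Concatenation. -/
def comp {u v w : T.Vert} (p : T.PathClass u v) (q : T.PathClass v w) : T.PathClass u w :=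
  Quot.map₂ (fun a b => ⟨a.1 ++ b.1, a.2.append b.2⟩)
    (fun a _ _ h => h.append_left a.1) (fun _ _ b h => h.append_right b.1) p q

/-- The class of the reversed path. -/
def symm {u v : T.Vert} (p : T.PathClass u v) : T.PathClass v u :=
  Quot.map (fun a => ⟨(a.1.map T.rev).reverse, a.2.reverse⟩) (fun _ _ h => h.reverse) p

theorem comp_assoc {u v w x : T.Vert} (p : T.PathClass u v) (q : T.PathClass v w)
    (r : T.PathClass w x) : (p.comp q).comp r = p.comp (q.comp r) := by
  induction p using Quot.ind
  induction q using Quot.ind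
  induction r using Quot.ind
  exact congrArg (Quot.mk _) (Subtype.ext (List.append_assoc _ _ _))

theorem nil_comp {u v : T.Vert} (p : T.PathClass u v) : (nil u).comp p = p := by
  induction p using Quot.ind
  rfl

theorem comp_nil {u v : T.Vert} (p : T.PathClass u v) : p.comp (nil v) = p := by
  induction p using Quot.ind
  exact congrArg (Quot.mk _) (Subtype.ext (List.append_nil _))

theorem symm_comp {u v : T.Vert} (p : T.PathClass u v) : p.symm.comp p = nil v := by
  induction p using Quot.ind with
  | mk a =>
    obtain ⟨l, hl⟩ := a
    induction l generalizing u with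
    | nil => cases hl; rfl
    | cons d l ih =>
      refine Eq.trans (Quot.sound ?_) (ih hl.2)
      have := HomotopyStep.backtrack (T := T) (l.map T.rev).reverse l (T.rev d)
      simpa [T.rev_rev] using this

end PathClass

variable (T)

/-- The fundamental group of the surface, as the edge path group. -/
abbrev FundGroup (x₀ : T.Vert) : Type _ := T.PathClass x₀ x₀

instance (x₀ : T.Vert) : Group (T.FundGroup x₀) :=
  @Group.ofLeftAxioms _ ⟨PathClass.comp⟩ ⟨PathClass.symm⟩ ⟨PathClass.nil x₀⟩
    PathClass.comp_assoc PathClass.nil_comp PathClass.symm_comp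

/-- The vertices of the triangulation lifted to the universal covering. -/
def UVert (x₀ : T.Vert) : Type _ := Σ v : T.Vert, T.PathClass x₀ v

/-- The fundamental group acts on the lifted vertices by deck transformations. -/
instance (x₀ : T.Vert) : MulAction (T.FundGroup x₀) (T.UVert x₀) where
  smul g α := ⟨α.1, PathClass.comp g α.2⟩
  one_smul α := Sigma.ext rfl (heq_of_eq (PathClass.nil_comp α.2))
  mul_smul g h α := Sigma.ext rfl (heq_of_eq (PathClass.comp_assoc g h α.2))

/-- The oriented edges of the triangulation lifted to the universal covering: a lifted initial
vertex together with an oriented edge of the surface that starts at its projection. -/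
@[ext]
structure UDart (x₀ : T.Vert) where
  src : T.UVert x₀
  dart : D
  src_dart : T.src dart = src.1

variable {T} in
/-- The terminal vertex of a lifted oriented edge. -/
def UDart.tgt {x₀ : T.Vert} (e : T.UDart x₀) : T.UVert x₀ :=
  ⟨T.tgt e.dart, e.src.2.comp (PathClass.single e.dart e.src_dart)⟩

variable {T} in
/-- The next lifted oriented edge, counterclockwise around the initial vertex. -/
def UDart.rot {x₀ : T.Vert} (e : T.UDart x₀) : T.UDart x₀ :=
  ⟨e.src, T.σ e.dart, (T.src_σ e.dart).trans e.src_dart⟩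

/-- The triangulation is quasi-simplicial: its lift to the universal covering is simplicial, that is,
has neither loops nor parallel edges. -/
def QuasiSimplicial (x₀ : T.Vert) : Prop :=
  (∀ e : T.UDart x₀, e.tgt ≠ e.src) ∧
  ∀ e e' : T.UDart x₀, e.src = e'.src → e.tgt = e'.tgt → e = e'

end OrientedTriangulation

/-! ### The projective line, disks and Hermitian matrices -/

/-- The projective line over the complex numbers. -/
abbrev CP1 : Type := ℙ ℂ (Fin 2 → ℂ)

/-- The quotient topology on the projective line. -/
noncomputable instance : TopologicalSpace CP1 :=
  TopologicalSpace.coinduced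
    (fun v : {v : Fin 2 → ℂ // v ≠ 0} => Projectivization.mk ℂ v.1 v.2) inferInstance

/-- The polarization of the quadratic form `X ↦ -det X` on Hermitian matrices. -/
noncomputable def mink (X Y : Matrix (Fin 2) (Fin 2) ℂ) : ℝ :=
  -((X + Y).det - X.det - Y.det).re / 2

/-- De Sitter space: Hermitian matrices with `⟨X, X⟩ = 1`, that is, `det X = -1`. -/
def deSitter : Set (Matrix (Fin 2) (Fin 2) ℂ) := {X | X.IsHermitian ∧ X.det = -1}

/-- Hyperbolic space: positive definite Hermitian matrices of determinant `1`. -/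
def hyperbolicSpace : Set (Matrix (Fin 2) (Fin 2) ℂ) := {X | X.PosDef ∧ X.det = 1}

/-- The open disk `{[z₀ : z₁] | ∑ Xᵢⱼ zᵢ z̄ⱼ < 0}`. -/
def disk (X : Matrix (Fin 2) (Fin 2) ℂ) : Set CP1 :=
  {p | (p.rep ⬝ᵥ (X *ᵥ star p.rep)).re < 0}

/-- `p` is the tangency point of the closures of the disks defined by `X` and `Y`. -/
def IsTangencyPoint (X Y : Matrix (Fin 2) (Fin 2) ℂ) (p : CP1) : Prop :=
  closure (disk X) ∩ closure (disk Y) = {p}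

theorem exists_eq_smul_of_leftRel {B C : SL(2, ℂ)}
    (h : (QuotientGroup.leftRel (Subgroup.center SL(2, ℂ))) B C) :
    ∃ r : ℂ, r * r = 1 ∧ (C : Matrix (Fin 2) (Fin 2) ℂ) = r • (B : Matrix (Fin 2) (Fin 2) ℂ) ∧
      ((C⁻¹ : SL(2, ℂ)) : Matrix (Fin 2) (Fin 2) ℂ)
        = r • ((B⁻¹ : SL(2, ℂ)) : Matrix (Fin 2) (Fin 2) ℂ) := by
  rw [QuotientGroup.leftRel_apply, Matrix.SpecialLinearGroup.mem_center_iff] at h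
  obtain ⟨r, hr, h⟩ := h
  have hC : (C : Matrix (Fin 2) (Fin 2) ℂ) = r • (B : Matrix (Fin 2) (Fin 2) ℂ) := by
    have : C = B * (B⁻¹ * C) := by group
    rw [this, Matrix.SpecialLinearGroup.coe_mul, ← h, Matrix.scalar_apply,
      ← Matrix.smul_one_eq_diagonal]
    simp
  refine ⟨r, by simpa [pow_two] using hr, hC, ?_⟩
  rw [Matrix.SpecialLinearGroup.coe_inv, Matrix.SpecialLinearGroup.coe_inv, hC,
    Matrix.adjugate_smul]
  simp

/-- The action `B · X = (B⁻¹)ᵀ X (B⁻¹)‾` of `PSL(2, ℂ)` on Hermitian matrices. -/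
noncomputable def hermAct (A : PSL(2, ℂ)) (X : Matrix (Fin 2) (Fin 2) ℂ) :
    Matrix (Fin 2) (Fin 2) ℂ :=
  Quotient.liftOn A
    (fun B : SL(2, ℂ) => ((B⁻¹ : SL(2, ℂ)) : Matrix (Fin 2) (Fin 2) ℂ)ᵀ * X *
      ((B⁻¹ : SL(2, ℂ)) : Matrix (Fin 2) (Fin 2) ℂ).map star)
    (by
      intro B C h
      obtain ⟨r, hr, -, hC⟩ := exists_eq_smul_of_leftRel h
      rcases mul_self_eq_one_iff.mp hr with rfl | rfl <;>
        simp [hC, ← Matrix.ext_iff, Matrix.mul_apply])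

/-- The adjoint action `B · A = B A B⁻¹` of `PSL(2, ℂ)`. -/
noncomputable def adjAct (A : PSL(2, ℂ)) (Y : Matrix (Fin 2) (Fin 2) ℂ) :
    Matrix (Fin 2) (Fin 2) ℂ :=
  Quotient.liftOn A
    (fun B : SL(2, ℂ) => (B : Matrix (Fin 2) (Fin 2) ℂ) * Y *
      ((B⁻¹ : SL(2, ℂ)) : Matrix (Fin 2) (Fin 2) ℂ))
    (by
      intro B C h
      obtain ⟨r, hr, hC, hC'⟩ := exists_eq_smul_of_leftRel h
      rcases mul_self_eq_one_iff.mp hr with rfl | rfl <;> simp [hC, hC'])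

/-- A representation is non-elementary if it has no finite orbit in hyperbolic space or in its
boundary, the projective line. -/
def NonElementary {G : Type*} [Group G] (ρ : G →* PSL(2, ℂ)) : Prop :=
  (¬ ∃ F : Set CP1, F.Finite ∧ F.Nonempty ∧ ∀ g, ∀ p ∈ F, ρ g • p ∈ F) ∧
  ¬ ∃ F : Set (Matrix (Fin 2) (Fin 2) ℂ), F.Finite ∧ F.Nonempty ∧ F ⊆ hyperbolicSpace ∧
    ∀ g, ∀ X ∈ F, hermAct (ρ g) X ∈ F

/-- The velocity at time `0` of the curve `exp (t A) · p` in the affine chart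
`[z₀ : z₁] ↦ (M z)₀ / (M z)₁`, that is, the coordinate at `p` of the projective vector field of `A`
in this chart. -/
noncomputable def coordVelocity (A : Matrix (Fin 2) (Fin 2) ℂ) (M : GL (Fin 2) ℂ) (p : CP1) : ℂ :=
  deriv (fun t : ℝ => (M.1 *ᵥ (NormedSpace.exp ((t : ℂ) • A) *ᵥ p.rep)) 0 /
    (M.1 *ᵥ (NormedSpace.exp ((t : ℂ) • A) *ᵥ p.rep)) 1) 0

/-- The projective vector fields of `A` and `B` take the same value at `p`: their coordinates agree
in every affine chart defined at `p`. -/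
def SameVelocityAt (A B : Matrix (Fin 2) (Fin 2) ℂ) (p : CP1) : Prop :=
  ∀ M : GL (Fin 2) ℂ, (M.1 *ᵥ p.rep) 1 ≠ 0 → coordVelocity A M p = coordVelocity B M p

/-- The point `[e^{iθ} : 1]` of the unit circle. -/
noncomputable def circlePoint (θ : ℝ) : CP1 :=
  Projectivization.mk ℂ ![Complex.exp (θ * Complex.I), 1] (fun h => by simpa using congrFun h 1)

/-! ### The packing locus -/

namespace OrientedTriangulation

variable {D : Type*} (T : OrientedTriangulation D)

/-- The tangency points of the disk at a vertex with the disks at the other endpoints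
`(rot^i e).tgt` of the edges issuing from it run counterclockwise exactly once around the boundary
of the disk, in the cyclic order that the oriented surface induces on these edges: in a projective
coordinate in which the disk is the unit disk `{[z : 1] | |z| < 1}` they are `exp (i θ₀)`,
`exp (i θ₁)`, … with `θ₀ < θ₁ < … < θ₀ + 2π`. -/
def TangenciesInCyclicOrder {x₀ : T.Vert} (S : T.UVert x₀ → deSitter) : Prop :=
  ∀ e : T.UDart x₀, ∃ (B : PSL(2, ℂ)) (θ : ℕ → ℝ),
    hermAct B (S e.src) = !![1, 0; 0, -1] ∧ StrictMono θ ∧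
    (∀ i, θ (i + Function.minimalPeriod T.σ e.dart) = θ i + 2 * Real.pi) ∧
    ∀ i, IsTangencyPoint (S e.src) (S (UDart.rot^[i] e).tgt) (B⁻¹ • circlePoint (θ i))

/-- The packing locus: pairs `(ρ, S)` of a non-elementary representation and a `ρ`-equivariant
selection map of disks, such that adjacent vertices are sent to tangent disks
(`⟨S α, S β⟩ + 1 = 0`, and `S α + S β` is not negative semidefinite), and such that the triangulation is
the nerve also as an oriented surface: the tangency points occur around each disk in the order of
the edges around the vertex. -/
structure InPackingLocus {x₀ : T.Vert} (ρ : T.FundGroup x₀ →* PSL(2, ℂ))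
    (S : T.UVert x₀ → deSitter) : Prop where
  nonElementary : NonElementary ρ
  equivariant : ∀ g α, (S (g • α) : Matrix (Fin 2) (Fin 2) ℂ) = hermAct (ρ g) (S α)
  mink_eq : ∀ e : T.UDart x₀, mink (S e.src) (S e.tgt) + 1 = 0
  not_neg : ∀ e : T.UDart x₀,
    ¬ (-((S e.src : Matrix (Fin 2) (Fin 2) ℂ) + (S e.tgt : Matrix (Fin 2) (Fin 2) ℂ))).PosSemidef
  cyclicOrder : T.TangenciesInCyclicOrder S

end OrientedTriangulation

/-! Let α be a vertex and p = [z] a tangency point on the circle of S(α). The rate at which the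
field of P(α) pushes p out of the disk (`outwardRate`) depends only on the value of the field at p.
If β is the neighbour tangent at p, then S(α) + S(β) annihilates the conjugate of z, so the rates
seen from α and from β are opposite. By equivariance the sign of the rate descends to an
antisymmetric function on the oriented edges of Σ (`InPackingLocus.exists_sign`). In a coordinate
that makes the circle the unit circle, the rate is a + b cos θ + c sin θ. Hence it vanishes at all
tangency points of the circle, or its signs change at most twice around α, however the zeros are
counted (`card_changes_le_two`).

Negative Euler characteristic rules out such a sign function unless it is zero (`sign_eq_zero`).
Otherwise let W be a component of the subgraph spanned by the vertices with some nonzero sign; the M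
oriented edges leaving W have sign zero. Complete the signs inside W to an orientation, and choose
the signs of the leaving edges so that a change precedes each of them. Each of the F triangles with
all corners in W has a corner with a change, so M + F ≤ 2|W|. If some triangle has exactly one
corner in W, this bound forces the subcomplex on W to have Euler characteristic 1 and leaves at most
two such triangles. The subcomplex then lifts to the universal covering, where the absence of loops
and parallel edges makes the sides opposite to these corners match (`matched_of_lift`). In every
case W and the triangles meeting it fill Σ, so the number of oriented edges is at most 3F + 3M ≤
6|W|, against 6χ = 6V - |D| < 0.

So all rates vanish. The hypothesis is complex linear, so the same holds for iP. Each circle carries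
at least three tangency points, hence both trigonometric polynomials vanish identically, and their
coefficients determine P(α). -/

/-! ### Tangent disks -/

/-- Half the derivative of `t ↦ (exp (t A) z) X (exp (t A) z)*` at `0`. If `[z]` lies on the boundary
of `disk X` its sign tells whether the projective field of `A` points out of the disk. -/
noncomputable def outwardRate (X A : Matrix (Fin 2) (Fin 2) ℂ) (z : Fin 2 → ℂ) : ℝ :=
  ((A *ᵥ z) ⬝ᵥ (X *ᵥ star z)).re

theorem outwardRate_smul (X A : Matrix (Fin 2) (Fin 2) ℂ) (c : ℂ) (z : Fin 2 → ℂ) :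
    outwardRate X A (c • z) = Complex.normSq c * outwardRate X A z := by
  have : (A *ᵥ (c • z)) ⬝ᵥ (X *ᵥ star (c • z)) =
      (Complex.normSq c : ℂ) * ((A *ᵥ z) ⬝ᵥ (X *ᵥ star z)) := by
    rw [star_smul, Matrix.mulVec_smul, Matrix.mulVec_smul, smul_dotProduct, dotProduct_smul,
      ← Complex.mul_conj]
    simp only [smul_eq_mul, Complex.star_def]
    ring
  rw [outwardRate, this, Complex.re_ofReal_mul, outwardRate]

theorem sign_outwardRate_smul (X A : Matrix (Fin 2) (Fin 2) ℂ) {c : ℂ} (hc : c ≠ 0)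
    (z : Fin 2 → ℂ) :
    SignType.sign (outwardRate X A (c • z)) = SignType.sign (outwardRate X A z) := by
  rw [outwardRate_smul, sign_mul, sign_pos (Complex.normSq_pos.mpr hc), one_mul]

/-- Cayley–Hamilton. -/
theorem sq_eq_trace_smul_of_det_eq_zero {K : Matrix (Fin 2) (Fin 2) ℂ} (h : K.det = 0) :
    K * K = K.trace • K := by
  rw [Matrix.det_fin_two] at h
  ext i j
  fin_cases i <;> fin_cases j <;>
    simp [Matrix.mul_apply, Fin.sum_univ_two, Matrix.trace_fin_two] <;>
      first | linear_combination (-1 : ℂ) * h | ring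

theorem det_add_eq_zero {X Y : Matrix (Fin 2) (Fin 2) ℂ} (hX : X ∈ deSitter) (hY : Y ∈ deSitter)
    (hm : mink X Y + 1 = 0) : (X + Y).det = 0 := by
  have hK : (X + Y).IsHermitian := hX.1.add hY.1
  apply Complex.ext
  · have := hm
    simp only [mink, hX.2, hY.2, Complex.sub_re, Complex.neg_re, Complex.one_re] at this
    simp only [Complex.zero_re]
    linarith
  · have : star (X + Y).det = (X + Y).det := by
      rw [← Matrix.det_conjTranspose, hK.eq]
    simpa using Complex.conj_eq_iff_im.mp this

/-- The squared length of `K v` for a singular Hermitian matrix. -/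
theorem star_mulVec_dotProduct_mulVec_of_det_eq_zero {K : Matrix (Fin 2) (Fin 2) ℂ}
    (hK : K.IsHermitian) (h : K.det = 0) (v : Fin 2 → ℂ) :
    star (K *ᵥ v) ⬝ᵥ (K *ᵥ v) = K.trace * (star v ⬝ᵥ (K *ᵥ v)) := by
  rw [Matrix.star_mulVec, hK.eq, ← Matrix.dotProduct_mulVec, Matrix.mulVec_mulVec,
    sq_eq_trace_smul_of_det_eq_zero h, Matrix.smul_mulVec, dotProduct_smul, smul_eq_mul]

theorem trace_eq_ofReal {K : Matrix (Fin 2) (Fin 2) ℂ} (hK : K.IsHermitian) :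
    K.trace = ((K.trace.re : ℝ) : ℂ) := by
  have : star K.trace = K.trace := by rw [← Matrix.trace_conjTranspose, hK.eq]
  exact (Complex.conj_eq_iff_re.mp this).symm

/-- A singular Hermitian K has eigenvalues 0 and tr K, so a trace ≤ 0 would make -K positive
semidefinite. -/
theorem trace_re_pos_of_not_neg {K : Matrix (Fin 2) (Fin 2) ℂ}
    (hK : K.IsHermitian) (h : K.det = 0) (hn : ¬ (-K).PosSemidef) : 0 < K.trace.re := by
  by_contra! ht
  apply hn
  have key := star_mulVec_dotProduct_mulVec_of_det_eq_zero hK h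
  rw [trace_eq_ofReal hK] at key
  rcases ht.lt_or_eq with ht | ht
  · refine Matrix.PosSemidef.of_dotProduct_mulVec_nonneg hK.neg fun v => ?_
    have h0 : (0 : ℂ) ≤ star (K *ᵥ v) ⬝ᵥ (K *ᵥ v) := dotProduct_star_self_nonneg _
    rw [key] at h0
    have : star v ⬝ᵥ (-K *ᵥ v) = ((-K.trace.re)⁻¹ : ℝ) *
        ((K.trace.re : ℂ) * (star v ⬝ᵥ (K *ᵥ v))) := by
      have : (K.trace.re : ℂ) ≠ 0 := by exact_mod_cast ht.ne
      rw [Matrix.neg_mulVec, dotProduct_neg]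
      push_cast
      field_simp
    rw [this]
    refine mul_nonneg ?_ h0
    exact_mod_cast inv_nonneg.mpr (by linarith)
  · have : K = 0 := by
      refine Matrix.ext_of_mulVec_single fun i => ?_
      have := key (Pi.single i 1)
      rw [ht, Complex.ofReal_zero, zero_mul, dotProduct_star_self_eq_zero] at this
      rw [this, Matrix.zero_mulVec]
    simp [this, Matrix.PosSemidef.zero]

theorem re_dotProduct_mulVec_star (K : Matrix (Fin 2) (Fin 2) ℂ) (hK : K.IsHermitian)
    (z : Fin 2 → ℂ) :
    star (star z) ⬝ᵥ (K *ᵥ star z) = (((z ⬝ᵥ (K *ᵥ star z)).re : ℝ) : ℂ) := by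
  have : star (z ⬝ᵥ (K *ᵥ star z)) = z ⬝ᵥ (K *ᵥ star z) := by
    rw [← Matrix.star_dotProduct_star, Matrix.star_mulVec, star_star, hK.eq, ← Matrix.dotProduct_mulVec]
  rw [star_star]
  exact (Complex.conj_eq_iff_re.mp this).symm

/-- The squared length of K z̄ is tr K, which is positive, times the value of the form at z. -/
theorem mulVec_star_eq_zero_of_nonpos {K : Matrix (Fin 2) (Fin 2) ℂ}
    (hK : K.IsHermitian) (h : K.det = 0) (hn : ¬ (-K).PosSemidef) {z : Fin 2 → ℂ}
    (hz : (z ⬝ᵥ (K *ᵥ star z)).re ≤ 0) : K *ᵥ star z = 0 := by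
  have ht := trace_re_pos_of_not_neg hK h hn
  have key := star_mulVec_dotProduct_mulVec_of_det_eq_zero hK h (star z)
  rw [re_dotProduct_mulVec_star K hK, trace_eq_ofReal hK] at key
  have h0 : (0 : ℂ) ≤ star (K *ᵥ star z) ⬝ᵥ (K *ᵥ star z) := dotProduct_star_self_nonneg _
  rw [← dotProduct_star_self_eq_zero]
  refine le_antisymm ?_ h0
  rw [key]
  exact_mod_cast mul_nonpos_of_nonneg_of_nonpos ht.le hz

/-- The kernel of a nonzero 2×2 matrix has dimension at most one; if z and w were independent,
Cramer's rule would give K = 0. -/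
theorem exists_smul_of_mulVec_star_eq_zero {K : Matrix (Fin 2) (Fin 2) ℂ} (hK : K ≠ 0)
    {z w : Fin 2 → ℂ} (hz : z ≠ 0) (hw : w ≠ 0) (hKz : K *ᵥ star z = 0) (hKw : K *ᵥ star w = 0) :
    ∃ c : ℂ, c ≠ 0 ∧ w = c • z := by
  have hdet : z 0 * w 1 - z 1 * w 0 = 0 := by
    by_contra hne
    have hne' : star (z 0) * star (w 1) - star (z 1) * star (w 0) ≠ 0 := by
      intro h
      apply hne
      have := congrArg star h
      simpa using this
    apply hK
    ext i j
    have h1 := congrFun hKz i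
    have h2 := congrFun hKw i
    simp only [Matrix.mulVec, dotProduct, Fin.sum_univ_two, Pi.star_apply, Pi.zero_apply] at h1 h2
    fin_cases j
    · refine (mul_eq_zero.mp ?_).resolve_right hne'
      simp only [Fin.zero_eta]
      linear_combination star (w 1) * h1 - star (z 1) * h2
    · refine (mul_eq_zero.mp ?_).resolve_right hne'
      simp only [Fin.mk_one]
      linear_combination star (z 0) * h2 - star (w 0) * h1
  have main : ∃ c : ℂ, w = c • z := by
    by_cases h0 : z 0 = 0
    · have h1 : z 1 ≠ 0 := by
        intro h1
        exact hz (by ext i; fin_cases i <;> assumption)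
      refine ⟨w 1 / z 1, ?_⟩
      ext i
      fin_cases i
      · simp only [Fin.zero_eta, Pi.smul_apply, smul_eq_mul]
        field_simp
        linear_combination -hdet
      · simp [h1]
    · refine ⟨w 0 / z 0, ?_⟩
      ext i
      fin_cases i
      · simp [h0]
      · simp only [Fin.mk_one, Pi.smul_apply, smul_eq_mul]
        field_simp
        linear_combination hdet
  obtain ⟨c, rfl⟩ := main
  exact ⟨c, fun hc => hw (by simp [hc]), rfl⟩

theorem form_smul (X : Matrix (Fin 2) (Fin 2) ℂ) (c : ℂ) (z : Fin 2 → ℂ) :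
    ((c • z) ⬝ᵥ (X *ᵥ star (c • z))).re = Complex.normSq c * (z ⬝ᵥ (X *ᵥ star z)).re := by
  -- The form itself is the outward rate of the identity matrix.
  simpa [outwardRate] using outwardRate_smul X 1 c z

theorem form_rep_mk_nonpos_iff (X : Matrix (Fin 2) (Fin 2) ℂ) {z : Fin 2 → ℂ} (hz : z ≠ 0) :
    ((Projectivization.mk ℂ z hz).rep ⬝ᵥ (X *ᵥ star (Projectivization.mk ℂ z hz).rep)).re ≤ 0 ↔
      (z ⬝ᵥ (X *ᵥ star z)).re ≤ 0 := by
  obtain ⟨a, ha⟩ := Projectivization.exists_smul_eq_mk_rep ℂ z hz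
  rw [← ha, Units.smul_def, form_smul, mul_nonpos_iff_pos_imp_nonpos]
  have := Complex.normSq_pos.mpr a.ne_zero
  constructor
  · intro h; exact h.1 this
  · intro h; exact ⟨fun _ => h, fun _ => this.le⟩

theorem form_nonpos_of_mem_closure_disk {X : Matrix (Fin 2) (Fin 2) ℂ} {p : CP1}
    (hp : p ∈ closure (disk X)) : (p.rep ⬝ᵥ (X *ᵥ star p.rep)).re ≤ 0 := by
  have hc : IsClosed {p : CP1 | (p.rep ⬝ᵥ (X *ᵥ star p.rep)).re ≤ 0} := by
    rw [isClosed_coinduced]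
    have : ((fun v : {v : Fin 2 → ℂ // v ≠ 0} => Projectivization.mk ℂ v.1 v.2) ⁻¹'
        {p : CP1 | (p.rep ⬝ᵥ (X *ᵥ star p.rep)).re ≤ 0}) =
        {v | (v.1 ⬝ᵥ (X *ᵥ star v.1)).re ≤ 0} := by
      ext v
      exact form_rep_mk_nonpos_iff X v.2
    rw [this]
    refine isClosed_le (Complex.continuous_re.comp ?_) continuous_const
    refine Continuous.dotProduct continuous_subtype_val ?_
    exact Continuous.matrix_mulVec continuous_const continuous_subtype_val.star
  have hsub : disk X ⊆ {p : CP1 | (p.rep ⬝ᵥ (X *ᵥ star p.rep)).re ≤ 0} := by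
    intro q hq
    exact le_of_lt (show (q.rep ⬝ᵥ (X *ᵥ star q.rep)).re < 0 from hq)
  exact closure_minimal hsub hc hp

/-- The tangency point of the disks of `X` and `Y` spans the kernel of `X + Y`. -/
theorem IsTangencyPoint.mulVec_star_eq_zero {X Y : Matrix (Fin 2) (Fin 2) ℂ} (hX : X ∈ deSitter)
    (hY : Y ∈ deSitter) (hm : mink X Y + 1 = 0) (hn : ¬ (-(X + Y)).PosSemidef) {p : CP1}
    (hp : IsTangencyPoint X Y p) : (X + Y) *ᵥ star p.rep = 0 := by
  have hmem : p ∈ closure (disk X) ∩ closure (disk Y) := by rw [hp]; rfl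
  refine mulVec_star_eq_zero_of_nonpos (hX.1.add hY.1) (det_add_eq_zero hX hY hm) hn ?_
  rw [Matrix.add_mulVec, dotProduct_add, Complex.add_re]
  exact add_nonpos (form_nonpos_of_mem_closure_disk hmem.1) (form_nonpos_of_mem_closure_disk hmem.2)

/-- Both forms are nonpositive on the closed disks, and their sum vanishes at the tangency point. -/
theorem IsTangencyPoint.form_eq_zero {X Y : Matrix (Fin 2) (Fin 2) ℂ} (hX : X ∈ deSitter)
    (hY : Y ∈ deSitter) (hm : mink X Y + 1 = 0) (hn : ¬ (-(X + Y)).PosSemidef) {p : CP1}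
    (hp : IsTangencyPoint X Y p) : p.rep ⬝ᵥ (X *ᵥ star p.rep) = 0 := by
  have hmem : p ∈ closure (disk X) ∩ closure (disk Y) := by rw [hp]; rfl
  have h0 := hp.mulVec_star_eq_zero hX hY hm hn
  have h1 := form_nonpos_of_mem_closure_disk hmem.1
  have h2 := form_nonpos_of_mem_closure_disk hmem.2
  have h3 : (p.rep ⬝ᵥ (X *ᵥ star p.rep)).re + (p.rep ⬝ᵥ (Y *ᵥ star p.rep)).re = 0 := by
    rw [← Complex.add_re, ← dotProduct_add, ← Matrix.add_mulVec, h0]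
    simp
  have h4 := re_dotProduct_mulVec_star X hX.1 p.rep
  rw [star_star] at h4
  rw [h4]
  exact_mod_cast (by linarith : (p.rep ⬝ᵥ (X *ᵥ star p.rep)).re = 0)

theorem ne_zero_of_not_neg {K : Matrix (Fin 2) (Fin 2) ℂ} (hn : ¬ (-K).PosSemidef) : K ≠ 0 := by
  rintro rfl
  exact hn (by simpa using Matrix.PosSemidef.zero)

/-! ### Projective vector fields -/

theorem coordVelocity_eq (A : Matrix (Fin 2) (Fin 2) ℂ) (M : GL (Fin 2) ℂ) (p : CP1)
    (hM : (M.1 *ᵥ p.rep) 1 ≠ 0) :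
    coordVelocity A M p =
      ((M.1 *ᵥ (A *ᵥ p.rep)) 0 * (M.1 *ᵥ p.rep) 1 - (M.1 *ᵥ p.rep) 0 * (M.1 *ᵥ (A *ᵥ p.rep)) 1) /
        (M.1 *ᵥ p.rep) 1 ^ 2 := by
  -- The exponential does not depend on a norm; one is chosen only in order to differentiate.
  let _ : NormedRing (Matrix (Fin 2) (Fin 2) ℂ) := Matrix.linftyOpNormedRing
  let _ : NormedAlgebra ℂ (Matrix (Fin 2) (Fin 2) ℂ) := Matrix.linftyOpNormedAlgebra
  have h1 : HasDerivAt (fun t : ℂ => NormedSpace.exp (t • A)) A 0 := by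
    have := hasDerivAt_exp_smul_const (𝕂 := ℂ) A (0 : ℂ)
    simp only [zero_smul, NormedSpace.exp_zero, one_mul] at this
    exact this
  have hcoord : ∀ i, HasDerivAt
      (fun t : ℝ => (M.1 *ᵥ (NormedSpace.exp ((t : ℂ) • A) *ᵥ p.rep)) i)
      ((M.1 *ᵥ (A *ᵥ p.rep)) i) 0 := by
    intro i
    let l : Matrix (Fin 2) (Fin 2) ℂ →ₗ[ℂ] ℂ :=
      { toFun := fun N => (M.1 *ᵥ (N *ᵥ p.rep)) i
        map_add' := by intro a b; rw [Matrix.add_mulVec, Matrix.mulVec_add, Pi.add_apply]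
        map_smul' := by intro a b; rw [Matrix.smul_mulVec, Matrix.mulVec_smul, Pi.smul_apply, RingHom.id_apply] }
    have h2 := (LinearMap.toContinuousLinearMap l).hasFDerivAt.comp_hasDerivAt (0 : ℂ) h1
    have h3 : HasDerivAt (fun t : ℝ => (LinearMap.toContinuousLinearMap l)
        (NormedSpace.exp ((t : ℂ) • A))) _ 0 :=
      HasDerivAt.comp_ofReal (z := (0 : ℝ)) (by simpa using h2)
    exact h3
  have hz : (M.1 *ᵥ (NormedSpace.exp (((0 : ℝ) : ℂ) • A) *ᵥ p.rep)) = M.1 *ᵥ p.rep := by simp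
  have := (hcoord 0).fun_div (hcoord 1) (by rw [hz]; exact hM)
  rw [coordVelocity, this.deriv, hz]

/-- The numerator of the coordinate velocity is det M times the wedge of A z with z. One of two
charts is defined at p: the standard one, or the one with swapped coordinates, whose determinant -1
accounts for the sign. -/
theorem SameVelocityAt.wedge_eq {A B : Matrix (Fin 2) (Fin 2) ℂ} {p : CP1}
    (h : SameVelocityAt A B p) :
    (A *ᵥ p.rep) 0 * p.rep 1 - p.rep 0 * (A *ᵥ p.rep) 1 =
      (B *ᵥ p.rep) 0 * p.rep 1 - p.rep 0 * (B *ᵥ p.rep) 1 := by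
  by_cases h1 : p.rep 1 = 0
  · have h0 : p.rep 0 ≠ 0 := fun h0 => p.rep_nonzero (by ext i; fin_cases i <;> assumption)
    let M : GL (Fin 2) ℂ :=
      Matrix.GeneralLinearGroup.mkOfDetNeZero !![0, 1; 1, 0] (by simp [Matrix.det_fin_two])
    have hM : ∀ v : Fin 2 → ℂ, M.1 *ᵥ v = ![v 1, v 0] := by
      intro v
      ext i
      fin_cases i <;> simp [M, Matrix.GeneralLinearGroup.mkOfDetNeZero, Matrix.mulVec, dotProduct]
    have hM1 : (M.1 *ᵥ p.rep) 1 ≠ 0 := by rw [hM]; simpa using h0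
    have := h M hM1
    rw [coordVelocity_eq _ _ _ hM1, coordVelocity_eq _ _ _ hM1,
      div_left_inj' (pow_ne_zero 2 hM1)] at this
    simp only [hM, Matrix.cons_val_zero, Matrix.cons_val_one] at this
    linear_combination -this
  · have hM1 : ((1 : GL (Fin 2) ℂ).1 *ᵥ p.rep) 1 ≠ 0 := by simpa using h1
    have := h 1 hM1
    rw [coordVelocity_eq _ _ _ hM1, coordVelocity_eq _ _ _ hM1,
      div_left_inj' (pow_ne_zero 2 hM1)] at this
    simpa using this

/-- If the fields of `A` and `B` agree at the boundary point `[z]` of `disk X` then they point out of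
the disk at the same rate. -/
theorem outwardRate_eq_of_wedge_eq {X A B : Matrix (Fin 2) (Fin 2) ℂ} {z : Fin 2 → ℂ} (hz : z ≠ 0)
    (hX : z ⬝ᵥ (X *ᵥ star z) = 0)
    (h : (A *ᵥ z) 0 * z 1 - z 0 * (A *ᵥ z) 1 = (B *ᵥ z) 0 * z 1 - z 0 * (B *ᵥ z) 1) :
    outwardRate X A z = outwardRate X B z := by
  simp only [outwardRate]
  congr 1
  have hX' : z 0 * (X *ᵥ star z) 0 + z 1 * (X *ᵥ star z) 1 = 0 := by
    simpa [dotProduct, Fin.sum_univ_two] using hX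
  simp only [dotProduct, Fin.sum_univ_two]
  by_cases h0 : z 0 = 0
  · have h1 : z 1 ≠ 0 := fun h1 => hz (by ext i; fin_cases i <;> assumption)
    refine mul_left_cancel₀ h1 ?_
    linear_combination (X *ᵥ star z) 0 * h + ((A *ᵥ z) 1 - (B *ᵥ z) 1) * hX'
  · refine mul_left_cancel₀ h0 ?_
    linear_combination -(X *ᵥ star z) 1 * h + ((A *ᵥ z) 0 - (B *ᵥ z) 0) * hX'

/-! ### Invariance and the unit circle -/

theorem star_mulVec_eq_map_star_mulVec (N : Matrix (Fin 2) (Fin 2) ℂ) (v : Fin 2 → ℂ) :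
    star (N *ᵥ v) = N.map star *ᵥ star v := by
  ext i
  simp only [Matrix.mulVec, dotProduct, Fin.sum_univ_two, Pi.star_apply, Matrix.map_apply, star_add,
    star_mul']

theorem hermAct_mulVec_star (B : SL(2, ℂ)) (X : Matrix (Fin 2) (Fin 2) ℂ) (z : Fin 2 → ℂ) :
    hermAct (QuotientGroup.mk B) X *ᵥ star ((B : Matrix (Fin 2) (Fin 2) ℂ) *ᵥ z) =
      ((B⁻¹ : SL(2, ℂ)) : Matrix (Fin 2) (Fin 2) ℂ)ᵀ *ᵥ (X *ᵥ star z) := by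
  have hB : ((B⁻¹ : SL(2, ℂ)) : Matrix (Fin 2) (Fin 2) ℂ) * B = 1 := by
    rw [← Matrix.SpecialLinearGroup.coe_mul]; simp
  change (((B⁻¹ : SL(2, ℂ)) : Matrix (Fin 2) (Fin 2) ℂ)ᵀ * X *
    ((B⁻¹ : SL(2, ℂ)) : Matrix (Fin 2) (Fin 2) ℂ).map star) *ᵥ _ = _
  rw [← Matrix.mulVec_mulVec, ← star_mulVec_eq_map_star_mulVec, Matrix.mulVec_mulVec, hB, Matrix.one_mulVec,
    Matrix.mulVec_mulVec]

theorem outwardRate_conj (B : SL(2, ℂ)) (X A : Matrix (Fin 2) (Fin 2) ℂ) (z : Fin 2 → ℂ) :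
    outwardRate (hermAct (QuotientGroup.mk B) X) (adjAct (QuotientGroup.mk B) A)
      ((B : Matrix (Fin 2) (Fin 2) ℂ) *ᵥ z) = outwardRate X A z := by
  have hB : ((B⁻¹ : SL(2, ℂ)) : Matrix (Fin 2) (Fin 2) ℂ) * B = 1 := by
    rw [← Matrix.SpecialLinearGroup.coe_mul]; simp
  have h1 := hermAct_mulVec_star B X z
  have h2 : adjAct (QuotientGroup.mk B) A *ᵥ ((B : Matrix (Fin 2) (Fin 2) ℂ) *ᵥ z) =
      (B : Matrix (Fin 2) (Fin 2) ℂ) *ᵥ (A *ᵥ z) := by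
    change ((B : Matrix (Fin 2) (Fin 2) ℂ) * A * ((B⁻¹ : SL(2, ℂ)) : Matrix (Fin 2) (Fin 2) ℂ)) *ᵥ _
      = _
    rw [Matrix.mulVec_mulVec, Matrix.mul_assoc, hB, Matrix.mul_one, Matrix.mulVec_mulVec]
  rw [outwardRate, h1, h2, Matrix.dotProduct_mulVec, Matrix.vecMul_transpose, Matrix.mulVec_mulVec,
    hB, Matrix.one_mulVec, outwardRate]

/-- Only three of the six real parameters of A survive; the other three describe motions that
preserve the unit circle. -/
theorem outwardRate_unitCircle (A : Matrix (Fin 2) (Fin 2) ℂ) (hA : A.trace = 0) (θ : ℝ) :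
    outwardRate !![1, 0; 0, -1] A ![Complex.exp (θ * Complex.I), 1] =
      2 * (A 0 0).re + ((A 0 1).re - (A 1 0).re) * Real.cos θ
        + ((A 0 1).im + (A 1 0).im) * Real.sin θ := by
  rw [Matrix.trace_fin_two] at hA
  have h11 : A 1 1 = - A 0 0 := by linear_combination hA
  have hcs := Real.cos_sq_add_sin_sq θ
  simp only [outwardRate, Complex.exp_mul_I]
  simp [Matrix.mulVec, dotProduct, Fin.sum_univ_two, h11, Complex.cos_ofReal_re,
    Complex.sin_ofReal_re]
  linear_combination (A 0 0).re * hcs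

/-! ### Sign changes of trigonometric polynomials of degree one -/

/-- `a + b cos θ + c sin θ` -/
noncomputable def trigLinear (a b c θ : ℝ) : ℝ := a + b * Real.cos θ + c * Real.sin θ

/-- In cos (t/2), sin (t/2) the function is a binary quadratic form. Such forms make up a space of
dimension three, so four values are linearly dependent, with Vandermonde-type coefficients. For
increasing angles within a period all the sines are positive, and the signs of the relation
alternate. -/
theorem trigLinear_relation (a b c t₀ t₁ t₂ t₃ : ℝ) :
    Real.sin ((t₂ - t₁) / 2) * Real.sin ((t₃ - t₁) / 2) * Real.sin ((t₃ - t₂) / 2) *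
        trigLinear a b c t₀
      - Real.sin ((t₂ - t₀) / 2) * Real.sin ((t₃ - t₀) / 2) * Real.sin ((t₃ - t₂) / 2) *
        trigLinear a b c t₁
      + Real.sin ((t₁ - t₀) / 2) * Real.sin ((t₃ - t₀) / 2) * Real.sin ((t₃ - t₁) / 2) *
        trigLinear a b c t₂
      - Real.sin ((t₁ - t₀) / 2) * Real.sin ((t₂ - t₀) / 2) * Real.sin ((t₂ - t₁) / 2) *
        trigLinear a b c t₃ = 0 := by
  have hf : ∀ t, trigLinear a b c t = (a + b) * Real.cos (t / 2) ^ 2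
      + 2 * c * (Real.cos (t / 2) * Real.sin (t / 2)) + (a - b) * Real.sin (t / 2) ^ 2 := by
    intro t
    have h1 := Real.cos_sq_add_sin_sq (t / 2)
    have h2 : Real.cos t = Real.cos (t / 2) ^ 2 - Real.sin (t / 2) ^ 2 := by
      rw [← Real.cos_two_mul']; ring_nf
    have h3 : Real.sin t = 2 * Real.sin (t / 2) * Real.cos (t / 2) := by
      rw [← Real.sin_two_mul]; ring_nf
    rw [trigLinear, h2, h3]
    linear_combination (-a) * h1
  have hs : ∀ s t : ℝ, Real.sin ((t - s) / 2) =
      Real.sin (t / 2) * Real.cos (s / 2) - Real.cos (t / 2) * Real.sin (s / 2) := by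
    intro s t
    rw [sub_div, Real.sin_sub]
  simp only [hf, hs]
  ring

theorem sin_half_sub_pos {s t : ℝ} (h : s < t) (h' : t < s + 2 * Real.pi) :
    0 < Real.sin ((t - s) / 2) :=
  Real.sin_pos_of_pos_of_lt_pi (by linarith) (by linarith)

theorem trigLinear_eq_zero_of_three_zeros {a b c t₀ t₁ t₂ : ℝ} (h01 : t₀ < t₁) (h12 : t₁ < t₂)
    (h20 : t₂ < t₀ + 2 * Real.pi) (h₀ : trigLinear a b c t₀ = 0) (h₁ : trigLinear a b c t₁ = 0)
    (h₂ : trigLinear a b c t₂ = 0) : a = 0 ∧ b = 0 ∧ c = 0 := by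
  have h : ∀ t, trigLinear a b c t = 0 := by
    intro t
    -- The fourth angle t is arbitrary; only its own coefficient has to be nonzero.
    have key := trigLinear_relation a b c t₀ t₁ t₂ t
    rw [h₀, h₁, h₂] at key
    have hw : 0 < Real.sin ((t₁ - t₀) / 2) * Real.sin ((t₂ - t₀) / 2) *
        Real.sin ((t₂ - t₁) / 2) :=
      mul_pos (mul_pos (sin_half_sub_pos h01 (by linarith)) (sin_half_sub_pos (by linarith) h20))
        (sin_half_sub_pos h12 (by linarith))
    refine (mul_eq_zero.mp ?_).resolve_left hw.ne'
    linarith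
  have e0 := h 0
  have e1 := h Real.pi
  have e2 := h (Real.pi / 2)
  simp only [trigLinear, Real.cos_zero, Real.sin_zero, Real.cos_pi, Real.sin_pi,
    Real.cos_pi_div_two, Real.sin_pi_div_two] at e0 e1 e2
  refine ⟨?_, ?_, ?_⟩ <;> linarith

/-- All four terms of the alternating relation are then nonnegative with sum zero, so every value
vanishes. -/
theorem trigLinear_eq_zero_of_alternating {a b c t₀ t₁ t₂ t₃ : ℝ} (h01 : t₀ < t₁) (h12 : t₁ < t₂)
    (h23 : t₂ < t₃) (h30 : t₃ < t₀ + 2 * Real.pi) (h₀ : 0 ≤ trigLinear a b c t₀)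
    (h₁ : trigLinear a b c t₁ ≤ 0) (h₂ : 0 ≤ trigLinear a b c t₂)
    (h₃ : trigLinear a b c t₃ ≤ 0) : a = 0 ∧ b = 0 ∧ c = 0 := by
  have key := trigLinear_relation a b c t₀ t₁ t₂ t₃
  have s01 := sin_half_sub_pos h01 (by linarith)
  have s02 := sin_half_sub_pos (h01.trans h12) (by linarith)
  have s03 := sin_half_sub_pos (h01.trans (h12.trans h23)) h30
  have s12 := sin_half_sub_pos h12 (by linarith)
  have s13 := sin_half_sub_pos (h12.trans h23) (by linarith)
  have s23 := sin_half_sub_pos h23 (by linarith)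
  have w0 := mul_pos (mul_pos s12 s13) s23
  have w1 := mul_pos (mul_pos s02 s03) s23
  have w2 := mul_pos (mul_pos s01 s03) s13
  have w3 := mul_pos (mul_pos s01 s02) s12
  have p0 := mul_nonneg w0.le h₀
  have p1 := mul_nonpos_of_nonneg_of_nonpos w1.le h₁
  have p2 := mul_nonneg w2.le h₂
  have p3 := mul_nonpos_of_nonneg_of_nonpos w3.le h₃
  have z0 := (mul_eq_zero.mp (le_antisymm (by linarith) p0)).resolve_left w0.ne'
  have z1 := (mul_eq_zero.mp (le_antisymm p1 (by linarith))).resolve_left w1.ne'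
  have z2 := (mul_eq_zero.mp (le_antisymm (by linarith) p2)).resolve_left w2.ne'
  exact trigLinear_eq_zero_of_three_zeros h01 h12 (by linarith) z0 z1 z2

theorem eq_of_no_change {α : Type*} (f : ℕ → α) {m n : ℕ} (hmn : m ≤ n)
    (h : ∀ i, m ≤ i → i < n → f i = f (i + 1)) : f n = f m := by
  induction n, hmn using Nat.le_induction with
  | base => rfl
  | succ n hmn ih =>
    rw [← h n hmn n.lt_succ_self]
    exact ih fun i hi hin => h i hi (hin.trans n.lt_succ_self)

/-- A periodic Boolean sequence with more than two changes in a period has four cyclically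
alternating terms. -/
theorem exists_alternating_of_two_lt_card_changes {ε : ℕ → Bool} {k : ℕ}
    (hε : ∀ i, ε (i + k) = ε i)
    (h : 2 < ((Finset.range k).filter fun i => ε i ≠ ε (i + 1)).card) :
    ∃ i₀ i₁ i₂ i₃, i₀ < i₁ ∧ i₁ < i₂ ∧ i₂ < i₃ ∧ i₃ < i₀ + k ∧
      ε i₁ = !ε i₀ ∧ ε i₂ = ε i₀ ∧ ε i₃ = !ε i₀ := by
  set C := (Finset.range k).filter fun i => ε i ≠ ε (i + 1) with hC
  have mem : ∀ {i}, i ∈ C ↔ i < k ∧ ε i ≠ ε (i + 1) := by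
    intro i; simp [hC]
  have hne : C.Nonempty := Finset.card_pos.mp (by omega)
  set p := C.min' hne with hp
  have hpC : p ∈ C := C.min'_mem hne
  have hc1 : (C.erase p).card = C.card - 1 := Finset.card_erase_of_mem hpC
  have hne1 : (C.erase p).Nonempty := Finset.card_pos.mp (by omega)
  set q := (C.erase p).min' hne1 with hq
  have hqC : q ∈ C.erase p := (C.erase p).min'_mem hne1
  have hc2 : ((C.erase p).erase q).card = (C.erase p).card - 1 := Finset.card_erase_of_mem hqC
  have hne2 : ((C.erase p).erase q).Nonempty := Finset.card_pos.mp (by omega)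
  set r := ((C.erase p).erase q).min' hne2 with hr
  have hrC : r ∈ (C.erase p).erase q := ((C.erase p).erase q).min'_mem hne2
  have hpq : p < q :=
    lt_of_le_of_ne (C.min'_le q (Finset.mem_of_mem_erase hqC)) (Finset.ne_of_mem_erase hqC).symm
  have hqr : q < r :=
    lt_of_le_of_ne ((C.erase p).min'_le r (Finset.mem_of_mem_erase hrC))
      (Finset.ne_of_mem_erase hrC).symm
  have hpC' := mem.mp hpC
  have hqC' := mem.mp (Finset.mem_of_mem_erase hqC)
  have hrC' := mem.mp (Finset.mem_of_mem_erase (Finset.mem_of_mem_erase hrC))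
  have e1 : ε q = ε (p + 1) := by
    refine eq_of_no_change ε hpq fun i hi hi' => ?_
    by_contra hne
    have : i ∈ C.erase p := Finset.mem_erase.mpr ⟨by omega, mem.mpr ⟨by omega, hne⟩⟩
    have := (C.erase p).min'_le i this
    omega
  have e2 : ε r = ε (q + 1) := by
    refine eq_of_no_change ε hqr fun i hi hi' => ?_
    by_contra hne
    have : i ∈ (C.erase p).erase q :=
      Finset.mem_erase.mpr ⟨by omega, Finset.mem_erase.mpr ⟨by omega, mem.mpr ⟨by omega, hne⟩⟩⟩
    have := ((C.erase p).erase q).min'_le i this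
    omega
  have b1 : ε q = !ε p := by
    rw [e1]; exact Bool.eq_not_of_ne (Ne.symm hpC'.2)
  have b2 : ε r = ε p := by
    rw [e2, Bool.eq_not_of_ne (Ne.symm hqC'.2), b1, Bool.not_not]
  have b3 : ε (r + 1) = !ε p := by
    rw [Bool.eq_not_of_ne (Ne.symm hrC'.2), b2]
  refine ⟨p, q, r, r + 1, hpq, hqr, r.lt_succ_self, ?_, b1, b2, b3⟩
  -- The only way to fail is r + 1 = p + k, and then periodicity contradicts the sign at r + 1.
  by_contra hlt
  have : r + 1 = p + k := by omega
  rw [this, hε] at b3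
  simp at b3

/-- A nonzero trigonometric polynomial of degree one has at most two weak sign changes. -/
theorem card_changes_le_two {a b c : ℝ} {θ : ℕ → ℝ} {k : ℕ} (hθ : StrictMono θ)
    (hθk : ∀ i, θ (i + k) = θ i + 2 * Real.pi) (hne : ∃ i, trigLinear a b c (θ i) ≠ 0)
    {ε : ℕ → Bool} (hε : ∀ i, ε (i + k) = ε i)
    (hpos : ∀ i, ε i = true → 0 ≤ trigLinear a b c (θ i))
    (hneg : ∀ i, ε i = false → trigLinear a b c (θ i) ≤ 0) :
    ((Finset.range k).filter fun i => ε i ≠ ε (i + 1)).card ≤ 2 := by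
  by_contra! h
  obtain ⟨i₀, i₁, i₂, i₃, h01, h12, h23, h30, b1, b2, b3⟩ :=
    exists_alternating_of_two_lt_card_changes hε h
  have t01 := hθ h01
  have t12 := hθ h12
  have t23 := hθ h23
  have t30 := hθ h30
  rw [hθk] at t30
  have hzero : a = 0 ∧ b = 0 ∧ c = 0 := by
    cases hb : ε i₀ with
    | true =>
      rw [hb] at b1 b2 b3
      exact trigLinear_eq_zero_of_alternating t01 t12 t23 t30 (hpos _ hb) (hneg _ b1) (hpos _ b2)
        (hneg _ b3)
    | false =>
      rw [hb] at b1 b2 b3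
      have hn : ∀ t, trigLinear (-a) (-b) (-c) t = -trigLinear a b c t := by
        intro t; simp only [trigLinear]; ring
      have := trigLinear_eq_zero_of_alternating (a := -a) (b := -b) (c := -c) t01 t12 t23 t30
        (by rw [hn]; linarith [hneg _ hb]) (by rw [hn]; linarith [hpos _ b1])
        (by rw [hn]; linarith [hneg _ b2]) (by rw [hn]; linarith [hpos _ b3])
      simpa using this
  obtain ⟨i, hi⟩ := hne
  obtain ⟨rfl, rfl, rfl⟩ := hzero
  simp [trigLinear] at hi

namespace OrientedTriangulation

variable {D : Type*} (T : OrientedTriangulation D)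

/-! ### Oriented edges -/

theorem σ_nxt (d : D) : T.σ (T.nxt d) = T.rev d := by
  simp [nxt]

theorem nxt_nxt_nxt (d : D) : T.nxt (T.nxt (T.nxt d)) = d := T.face_three d

theorem rev_nxt_nxt (d : D) : T.rev (T.nxt (T.nxt d)) = T.σ d := by
  rw [← T.σ_nxt, T.nxt_nxt_nxt]

theorem rev_σ (d : D) : T.rev (T.σ d) = T.nxt (T.nxt d) := by
  rw [← T.rev_nxt_nxt, T.rev_rev]

theorem nxt_ne (d : D) : T.nxt d ≠ d := T.face_ne d

theorem nxt_nxt_ne (d : D) : T.nxt (T.nxt d) ≠ d := fun h =>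
  T.nxt_ne d (by conv_rhs => rw [← T.nxt_nxt_nxt d, h])

theorem src_nxt (d : D) : T.src (T.nxt d) = T.tgt d := by
  rw [← T.src_σ, T.σ_nxt]
  rfl

theorem tgt_nxt (d : D) : T.tgt (T.nxt d) = T.tgt (T.σ d) := by
  rw [← T.src_nxt, ← T.rev_σ]
  rfl

theorem tgt_nxt_nxt (d : D) : T.tgt (T.nxt (T.nxt d)) = T.src d := by
  rw [← T.src_nxt, T.nxt_nxt_nxt]

theorem src_rev (d : D) : T.src (T.rev d) = T.tgt d := rfl

theorem src_σ_inv (d : D) : T.src (T.σ⁻¹ d) = T.src d := by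
  simpa using (T.src_σ (T.σ⁻¹ d)).symm

/-- An injective self-map of a finite set is onto. -/
theorem mem_iff_of_mapsTo [Finite D] {K : Set D} (f : Equiv.Perm D) (h : ∀ d ∈ K, f d ∈ K) (d : D) :
    d ∈ K ↔ f d ∈ K := by
  refine ⟨h d, fun hd => ?_⟩
  have himg : Set.image f K = K := by
    refine Set.eq_of_subset_of_ncard_le (by rintro _ ⟨x, hx, rfl⟩; exact h x hx) ?_ K.toFinite
    rw [Set.ncard_image_of_injective _ f.injective]
  rw [← himg] at hd
  obtain ⟨x, hx, hxd⟩ := hd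
  rwa [← f.injective hxd]

/-- A nonempty set of oriented edges closed under reversal and rotation is everything. -/
theorem eq_univ_of_closed [Finite D] {K : Set D} (hne : K.Nonempty) (hσ : ∀ d ∈ K, T.σ d ∈ K)
    (hrev : ∀ d ∈ K, T.rev d ∈ K) : K = Set.univ := by
  have key : ∀ g ∈ Subgroup.closure {T.σ, T.rev}, ∀ d, d ∈ K ↔ g d ∈ K := by
    intro g hg
    induction hg using Subgroup.closure_induction with
    | mem g hg =>
      rcases hg with rfl | rfl
      · exact mem_iff_of_mapsTo _ hσ
      · exact mem_iff_of_mapsTo _ hrev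
    | one => intro d; rfl
    | mul g h _ _ ihg ihh => intro d; rw [ihh, ihg]; rfl
    | inv g _ ih => intro d; simpa using (ih (g⁻¹ d)).symm
  obtain ⟨d₀, hd₀⟩ := hne
  refine Set.eq_univ_of_forall fun d => ?_
  obtain ⟨g, hg, rfl⟩ := T.connected d₀ d
  exact (key g hg d₀).mp hd₀

theorem nonempty_pathClass [Finite D] (x₀ v : T.Vert) : Nonempty (T.PathClass x₀ v) := by
  have : {d : D | Nonempty (T.PathClass x₀ (T.src d))} = Set.univ := by
    refine T.eq_univ_of_closed ?_ ?_ ?_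
    · obtain ⟨d, rfl⟩ := Quotient.exists_rep x₀
      exact ⟨d, ⟨PathClass.nil _⟩⟩
    · rintro d ⟨c⟩
      change Nonempty (T.PathClass x₀ (T.src (T.σ d)))
      rw [T.src_σ]
      exact ⟨c⟩
    · rintro d ⟨c⟩
      exact ⟨c.comp (PathClass.single d rfl)⟩
  obtain ⟨d, rfl⟩ := Quotient.exists_rep v
  exact (Set.eq_univ_iff_forall.mp this d)

/-! ### Lifted oriented edges -/

variable {T} {x₀ : T.Vert}

theorem UVert.eq_of_homotopyStep {l m : List D} {v w : T.Vert} (hl : T.IsWalk x₀ l v)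
    (hm : T.IsWalk x₀ m w) (hvw : v = w) (h : T.HomotopyStep l m) :
    (⟨v, Quot.mk _ ⟨l, hl⟩⟩ : T.UVert x₀) = ⟨w, Quot.mk _ ⟨m, hm⟩⟩ := by
  subst hvw
  exact Sigma.ext rfl (heq_of_eq (Quot.sound h))

namespace UDart

/-- The reversed lifted oriented edge. -/
def rev (e : T.UDart x₀) : T.UDart x₀ := ⟨e.tgt, T.rev e.dart, rfl⟩

/-- The next oriented edge in the boundary of the lifted face on the left. -/
def nxt (e : T.UDart x₀) : T.UDart x₀ := ⟨e.tgt, T.nxt e.dart, T.src_nxt e.dart⟩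

theorem tgt_rev (e : T.UDart x₀) : e.rev.tgt = e.src := by
  obtain ⟨⟨v, c⟩, d, h⟩ := e
  induction c using Quot.ind with
  | mk a =>
    obtain ⟨l, hl⟩ := a
    refine UVert.eq_of_homotopyStep _ _ ((T.tgt_rev d).trans h) ?_
    have := HomotopyStep.backtrack (T := T) l [] d
    rw [List.append_nil] at this
    simp only [List.append_assoc]
    exact this

theorem tgt_nxt_nxt (e : T.UDart x₀) : e.nxt.nxt.tgt = e.src := by
  obtain ⟨⟨v, c⟩, d, h⟩ := e
  induction c using Quot.ind with
  | mk a =>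
    obtain ⟨l, hl⟩ := a
    refine UVert.eq_of_homotopyStep _ _ ((T.tgt_nxt_nxt d).trans h) ?_
    have := HomotopyStep.face (T := T) l [] d
    rw [List.append_nil] at this
    simp only [List.append_assoc]
    exact this

/-- The boundary of a face closes up in the universal covering, so the third side, reversed, starts
at the original lifted vertex. -/
theorem rot_eq (e : T.UDart x₀) : e.rot = e.nxt.nxt.rev :=
  UDart.ext e.tgt_nxt_nxt.symm (T.rev_nxt_nxt e.dart).symm

theorem tgt_rot (e : T.UDart x₀) : e.rot.tgt = e.nxt.tgt := by
  rw [rot_eq, tgt_rev]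
  rfl

theorem src_rot_iterate (e : T.UDart x₀) (i : ℕ) : (rot^[i] e).src = e.src := by
  induction i with
  | zero => rfl
  | succ i ih => rw [Function.iterate_succ_apply']; exact ih

theorem dart_rot_iterate (e : T.UDart x₀) (i : ℕ) : (rot^[i] e).dart = T.σ^[i] e.dart := by
  induction i with
  | zero => rfl
  | succ i ih =>
    rw [Function.iterate_succ_apply', Function.iterate_succ_apply', ← ih]
    rfl

end UDart

/-- The lift of an oriented edge that starts at the lift of its initial vertex. -/
def liftDart {L : T.Vert → T.UVert x₀} (hL : ∀ v, (L v).1 = v) (d : D) : T.UDart x₀ :=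
  ⟨L (T.src d), d, (hL _).symm⟩

theorem rot_liftDart {L : T.Vert → T.UVert x₀} (hL : ∀ v, (L v).1 = v) (d : D) :
    (liftDart hL d).rot = liftDart hL (T.σ d) :=
  UDart.ext (congrArg L (T.src_σ d)).symm rfl

theorem tgt_nxt_liftDart {L : T.Vert → T.UVert x₀} (hL : ∀ v, (L v).1 = v) (d : D) :
    (liftDart hL d).nxt.tgt = (liftDart hL (T.σ d)).tgt := by
  rw [← UDart.tgt_rot, rot_liftDart]

/-! ### Lifting trees and subcomplexes of positive Euler characteristic -/

variable (T)

/-- `L` is a lift to the universal covering over the oriented edges in `A`. -/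
def IsLiftOn (L : T.Vert → T.UVert x₀) (A : Finset D) : Prop :=
  ∀ e : T.UDart x₀, e.dart ∈ A → e.src = L (T.src e.dart) → e.tgt = L (T.tgt e.dart)

variable [DecidableEq D]

theorem card_pair_rev (d : D) : ({d, T.rev d} : Finset D).card = 2 :=
  Finset.card_pair (T.rev_ne d).symm

variable [Fintype D]

/-- Subtrees of every size of a connected graph. -/
theorem exists_subtree (x₀ : T.Vert) {W : Finset T.Vert} {w₀ : T.Vert} (hw₀ : w₀ ∈ W) {A : Finset D}
    (hrev : ∀ d ∈ A, T.rev d ∈ A) (hAW : ∀ d ∈ A, T.src d ∈ W)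
    (hconn : ∀ B ⊆ W, w₀ ∈ B → (∀ d ∈ A, T.src d ∈ B → T.tgt d ∈ B) → B = W)
    (n : ℕ) (hn : n + 1 ≤ W.card) :
    ∃ B ⊆ W, w₀ ∈ B ∧ B.card = n + 1 ∧ ∃ A' ⊆ A, (∀ d ∈ A', T.rev d ∈ A') ∧ A'.card = 2 * n ∧
      (∀ d ∈ A', T.src d ∈ B) ∧
      ∃ L : T.Vert → T.UVert x₀, (∀ v, (L v).1 = v) ∧ T.IsLiftOn L A' := by
  classical
  induction n with
  | zero =>
    -- The initial lifts are arbitrary, since no edge constrains them yet; each new tree edge will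
    -- correct the lift of its new endpoint.
    refine ⟨{w₀}, by simpa using hw₀, by simp, by simp, ∅, by simp, by simp, by simp, by simp,
      fun v => ⟨v, (T.nonempty_pathClass x₀ v).some⟩, fun v => rfl, ?_⟩
    intro e he
    simp at he
  | succ n ih =>
    obtain ⟨B, hBW, hwB, hB, A', hA', hrev', hcard, hsrc, L, hL, hlift⟩ := ih (by omega)
    have hne : B ≠ W := by rintro rfl; omega
    have hex : ∃ d ∈ A, T.src d ∈ B ∧ T.tgt d ∉ B := by
      by_contra! h
      exact hne (hconn B hBW hwB h)
    obtain ⟨d, hdA, hds, hdt⟩ := hex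
    have hdt' : T.tgt d ∈ W := hAW _ (hrev d hdA)
    have hdA' : d ∉ A' := fun h => hdt (hsrc _ (hrev' d h))
    have hrdA' : T.rev d ∉ A' := fun h => hdt (hsrc _ h)
    let e₀ : T.UDart x₀ := ⟨L (T.src d), d, (hL _).symm⟩
    have hst : T.src d ≠ T.tgt d := fun h => hdt (h ▸ hds)
    refine ⟨insert (T.tgt d) B, Finset.insert_subset hdt' hBW, Finset.mem_insert_of_mem hwB,
      by rw [Finset.card_insert_of_notMem hdt, hB], {d, T.rev d} ∪ A', ?_, ?_, ?_, ?_,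
      Function.update L (T.tgt d) e₀.tgt, ?_, ?_⟩
    · refine Finset.union_subset ?_ hA'
      simp [Finset.insert_subset_iff, hdA, hrev d hdA]
    · intro x hx
      simp only [Finset.mem_union, Finset.mem_insert, Finset.mem_singleton] at hx ⊢
      rcases hx with (rfl | rfl) | hx
      · simp
      · simp [T.rev_rev]
      · exact Or.inr (hrev' x hx)
    · rw [Finset.card_union_of_disjoint, T.card_pair_rev, hcard]
      · ring
      · simp [Finset.disjoint_insert_left, hdA', hrdA']
    · intro x hx
      simp only [Finset.mem_union, Finset.mem_insert, Finset.mem_singleton] at hx ⊢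
      rcases hx with (rfl | rfl) | hx
      · exact Or.inr hds
      · exact Or.inl rfl
      · exact Or.inr (hsrc x hx)
    · intro v
      by_cases hv : v = T.tgt d
      · subst hv
        rw [Function.update_self]
        rfl
      · rw [Function.update_of_ne hv, hL]
    · intro e he hsrce
      simp only [Finset.mem_union, Finset.mem_insert, Finset.mem_singleton] at he
      rcases he with (he | he) | he
      · rw [he, Function.update_of_ne hst] at hsrce
        have : e = e₀ := UDart.ext hsrce he
        rw [he, Function.update_self, this]
      · rw [he, T.src_rev, Function.update_self] at hsrce
        have : e = e₀.rev := UDart.ext hsrce he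
        rw [he, T.tgt_rev, Function.update_of_ne hst, this, UDart.tgt_rev]
      · have h1 : T.src e.dart ≠ T.tgt d := fun h => hdt (h ▸ hsrc _ he)
        have h2 : T.tgt e.dart ≠ T.tgt d := fun h => hdt (h ▸ hsrc _ (hrev' _ he))
        rw [Function.update_of_ne h1] at hsrce
        rw [Function.update_of_ne h2]
        exact hlift e he hsrce

/-- A connected graph of Euler characteristic `> 0` is a tree, and lifts to the universal
covering. -/
theorem exists_lift_of_graph (x₀ : T.Vert) {W : Finset T.Vert} {w₀ : T.Vert} (hw₀ : w₀ ∈ W)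
    {A : Finset D} (hrev : ∀ d ∈ A, T.rev d ∈ A) (hAW : ∀ d ∈ A, T.src d ∈ W)
    (hconn : ∀ B ⊆ W, w₀ ∈ B → (∀ d ∈ A, T.src d ∈ B → T.tgt d ∈ B) → B = W)
    (hX : A.card < 2 * W.card) :
    2 * W.card ≤ A.card + 2 ∧
      ∃ L : T.Vert → T.UVert x₀, (∀ v, (L v).1 = v) ∧ T.IsLiftOn L A := by
  have hpos : 0 < W.card := Finset.card_pos.mpr ⟨w₀, hw₀⟩
  obtain ⟨B, -, -, -, A', hA', hrev', hcard, -, L, hL, hlift⟩ :=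
    T.exists_subtree x₀ hw₀ hrev hAW hconn (W.card - 1) (by omega)
  -- A spanning tree uses 2(|W| - 1) oriented edges; one more edge would bring `A` to at least 2|W|.
  have hAA' : A' = A := by
    by_contra hne
    obtain ⟨d, hd, hd'⟩ := Finset.exists_of_ssubset (hA'.ssubset_of_ne hne)
    have hrd' : T.rev d ∉ A' := fun h => hd' (by simpa [T.rev_rev] using hrev' _ h)
    have hsub : {d, T.rev d} ∪ A' ⊆ A := by
      refine Finset.union_subset ?_ hA'
      simp [Finset.insert_subset_iff, hd, hrev d hd]
    have := Finset.card_le_card hsub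
    rw [Finset.card_union_of_disjoint (by simp [Finset.disjoint_insert_left, hd', hrd']),
      T.card_pair_rev] at this
    omega
  subst hAA'
  exact ⟨by omega, L, hL, hlift⟩

/-- A connected proper subcomplex, with vertices `W`, edges `A` and faces `Φ`, of Euler characteristic
`> 0` has Euler characteristic `1`, and lifts to the universal covering. -/
theorem exists_lift_of_complex (x₀ : T.Vert) {W : Finset T.Vert} {w₀ : T.Vert} (hw₀ : w₀ ∈ W)
    {A Φ : Finset D} (hrev : ∀ d ∈ A, T.rev d ∈ A) (hAW : ∀ d ∈ A, T.src d ∈ W)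
    (hconn : ∀ B ⊆ W, w₀ ∈ B → (∀ d ∈ A, T.src d ∈ B → T.tgt d ∈ B) → B = W)
    (hΦA : Φ ⊆ A) (hΦ : ∀ d ∈ Φ, T.nxt d ∈ Φ) (hΦne : Φ ≠ Finset.univ)
    (hX : 3 * A.card < 6 * W.card + 2 * Φ.card) :
    6 * W.card + 2 * Φ.card ≤ 3 * A.card + 6 ∧
      ∃ L : T.Vert → T.UVert x₀, (∀ v, (L v).1 = v) ∧ T.IsLiftOn L A := by
  -- With two oriented edges per edge and three per face, the hypothesis `hX` says 6χ > 0. A face is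
  -- deleted together with a free edge, which preserves χ, the vertices and connectedness, until a
  -- graph is left.
  induction hn : Φ.card using Nat.strong_induction_on generalizing A Φ with
  | _ n ih =>
  subst hn
  rcases Φ.eq_empty_or_nonempty with rfl | hne
  · simp only [Finset.card_empty] at hX ⊢
    obtain ⟨h1, h2⟩ := T.exists_lift_of_graph x₀ hw₀ hrev hAW hconn (by omega)
    exact ⟨by omega, h2⟩
  have hfree : ∃ d ∈ Φ, T.rev d ∉ Φ := by
    by_contra! h
    apply hΦne
    -- Without a free edge the faces would form a closed surface, hence all of Σ.
    have : (Φ : Set D) = Set.univ := by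
      refine T.eq_univ_of_closed (by simpa using hne) ?_ (by simpa using h)
      intro d hd
      rw [← T.rev_nxt_nxt]
      exact h _ (hΦ _ (hΦ _ hd))
    simpa using this
  obtain ⟨d, hd, hrd⟩ := hfree
  have hn1 := hΦ d hd
  have hn2 := hΦ _ hn1
  have hd1 : T.nxt d ≠ T.rev d := fun h => hrd (h ▸ hn1)
  have hd2 : T.nxt (T.nxt d) ≠ T.rev d := fun h => hrd (h ▸ hn2)
  have hr1 : T.rev (T.nxt d) ≠ d := fun h => hrd (by rw [← h, T.rev_rev]; exact hn1)
  have hr2 : T.rev (T.nxt (T.nxt d)) ≠ d := fun h => hrd (by rw [← h, T.rev_rev]; exact hn2)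
  have hrr1 : T.rev (T.nxt d) ≠ T.rev d := fun h => T.nxt_ne d (T.rev.injective h)
  have hrr2 : T.rev (T.nxt (T.nxt d)) ≠ T.rev d := fun h => T.nxt_nxt_ne d (T.rev.injective h)
  have h12 : T.nxt d ≠ T.nxt (T.nxt d) := fun h => T.nxt_ne d (T.nxt.injective h).symm
  set A' := A \ {d, T.rev d} with hA'
  set Φ' := Φ \ {d, T.nxt d, T.nxt (T.nxt d)} with hΦ'
  have memA' : ∀ {x}, x ∈ A' ↔ x ∈ A ∧ x ≠ d ∧ x ≠ T.rev d := by
    intro x; simp [hA', not_or]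
  have memΦ' : ∀ {x}, x ∈ Φ' ↔ x ∈ Φ ∧ x ≠ d ∧ x ≠ T.nxt d ∧ x ≠ T.nxt (T.nxt d) := by
    intro x; simp [hΦ', not_or]
  have m1 : T.nxt d ∈ A' := memA'.mpr ⟨hΦA hn1, T.nxt_ne d, hd1⟩
  have m2 : T.nxt (T.nxt d) ∈ A' := memA'.mpr ⟨hΦA hn2, T.nxt_nxt_ne d, hd2⟩
  have mr1 : T.rev (T.nxt d) ∈ A' := memA'.mpr ⟨hrev _ (hΦA hn1), hr1, hrr1⟩
  have mr2 : T.rev (T.nxt (T.nxt d)) ∈ A' := memA'.mpr ⟨hrev _ (hΦA hn2), hr2, hrr2⟩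
  have cA : A'.card + 2 = A.card := by
    rw [← T.card_pair_rev d]
    exact Finset.card_sdiff_add_card_eq_card
      (by simp [Finset.insert_subset_iff, hΦA hd, hrev _ (hΦA hd)])
  have cΦ : Φ'.card + 3 = Φ.card := by
    have h3 : ({d, T.nxt d, T.nxt (T.nxt d)} : Finset D).card = 3 :=
      Finset.card_eq_three.mpr ⟨_, _, _, (T.nxt_ne d).symm, (T.nxt_nxt_ne d).symm, h12, rfl⟩
    rw [← h3]
    exact Finset.card_sdiff_add_card_eq_card (by simp [Finset.insert_subset_iff, hd, hn1, hn2])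
  have key := ih Φ'.card (by omega) (A := A') (Φ := Φ') ?_ ?_ ?_ ?_ ?_ ?_ (by omega) rfl
  · obtain ⟨h1, L, hL, hlift⟩ := key
    refine ⟨by omega, L, hL, ?_⟩
    -- The lift extends over the deleted edge because the other two sides of the face are lifted and
    -- the lifted face closes up.
    have hlift_d : ∀ e : T.UDart x₀, e.dart = d → e.src = L (T.src d) → e.tgt = L (T.tgt d) := by
      intro e hed hes
      have e1 : e.rot.tgt = L (T.tgt (T.σ d)) := by
        have := hlift e.rot (by
          change T.σ e.dart ∈ A'
          rw [hed, ← T.rev_nxt_nxt]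
          exact mr2) (by
          change e.src = L (T.src (T.σ e.dart))
          rw [hes, hed, T.src_σ])
        rw [this]
        change L (T.tgt (T.σ e.dart)) = _
        rw [hed]
      have e2 := hlift e.nxt.rev (by
          change T.rev (T.nxt e.dart) ∈ A'
          rw [hed]
          exact mr1) (by
          change e.nxt.tgt = L (T.tgt (T.nxt e.dart))
          rw [← UDart.tgt_rot, e1, hed, T.tgt_nxt])
      rw [UDart.tgt_rev] at e2
      change e.tgt = L (T.tgt (T.rev (T.nxt e.dart))) at e2
      rw [e2, T.tgt_rev, T.src_nxt, hed]
    intro e he hes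
    by_cases h : e.dart = d
    · rw [h] at hes ⊢
      exact hlift_d e h hes
    by_cases h' : e.dart = T.rev d
    · let f : T.UDart x₀ := ⟨L (T.src d), d, (hL _).symm⟩
      have hf := hlift_d f rfl rfl
      have : e = f.rev := by
        refine UDart.ext ?_ h'
        rw [hes, h']
        exact hf.symm
      rw [this, UDart.tgt_rev]
      change L (T.src d) = L (T.tgt (T.rev d))
      rw [T.tgt_rev]
    · exact hlift e (memA'.mpr ⟨he, h, h'⟩) hes
  · intro x hx
    obtain ⟨h1, h2, h3⟩ := memA'.mp hx
    refine memA'.mpr ⟨hrev x h1, fun h => h3 ?_, fun h => h2 (T.rev.injective h)⟩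
    rw [← h, T.rev_rev]
  · intro x hx
    exact hAW x (memA'.mp hx).1
  · intro B hBW hwB hB
    refine hconn B hBW hwB fun x hx hxB => ?_
    -- A path along the other two sides of the deleted face replaces the deleted edge.
    by_cases h : x = d
    · subst h
      have s1 : T.tgt (T.rev (T.nxt (T.nxt x))) ∈ B := by
        refine hB _ mr2 ?_
        rw [T.src_rev, T.tgt_nxt_nxt]
        exact hxB
      rw [T.tgt_rev, T.src_nxt] at s1
      have s2 := hB _ mr1 s1
      rwa [T.tgt_rev, T.src_nxt] at s2
    by_cases h' : x = T.rev d
    · subst h'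
      rw [T.src_rev, ← T.src_nxt] at hxB
      have s1 := hB _ m1 hxB
      rw [← T.src_nxt] at s1
      have s2 := hB _ m2 s1
      rwa [T.tgt_nxt_nxt, ← T.tgt_rev] at s2
    · exact hB x (memA'.mpr ⟨hx, h, h'⟩) hxB
  · intro x hx
    obtain ⟨h1, h2, h3, h4⟩ := memΦ'.mp hx
    exact memA'.mpr ⟨hΦA h1, h2, fun h => hrd (h ▸ h1)⟩
  · intro x hx
    obtain ⟨h1, h2, h3, h4⟩ := memΦ'.mp hx
    refine memΦ'.mpr ⟨hΦ x h1, fun h => h4 ?_, fun h => h2 (T.nxt.injective h),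
      fun h => h3 (T.nxt.injective h)⟩
    rw [← h, T.nxt_nxt_nxt]
  · intro h
    have : d ∈ Φ' := h ▸ Finset.mem_univ d
    exact (memΦ'.mp this).2.1 rfl

end OrientedTriangulation

namespace OrientedTriangulation

variable {D : Type*} (T : OrientedTriangulation D)

/-! ### The Euler characteristic -/

theorem card_sameCycle_quotient_mul [Fintype D] (f : Equiv.Perm D) (n : ℕ)
    (h : ∀ d, {x | f.SameCycle d x}.ncard = n) :
    Nat.card (Quotient (Equiv.Perm.SameCycle.setoid f)) * n = Fintype.card D := by
  classical
  rw [Nat.card_eq_fintype_card, ← Finset.card_univ (α := D),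
    Finset.card_eq_sum_card_fiberwise (t := Finset.univ)
      (f := fun d => (Quotient.mk (Equiv.Perm.SameCycle.setoid f) d)) (by simp)]
  rw [Finset.sum_const_nat (m := n), Finset.card_univ]
  intro q _
  induction q using Quotient.ind with
  | _ d =>
  rw [← h d, ← Set.ncard_coe_finset]
  congr 1
  ext x
  simp only [Finset.coe_filter, Finset.mem_univ, true_and, Set.mem_ofPred_eq, Quotient.eq]
  exact Equiv.Perm.sameCycle_comm

theorem sameCycle_subset_of_mapsTo [Finite D] (f : Equiv.Perm D) {K : Set D} {d : D} (hd : d ∈ K)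
    (hK : ∀ x ∈ K, f x ∈ K) {x : D} (hx : f.SameCycle d x) : x ∈ K := by
  obtain ⟨i, rfl⟩ := hx.exists_nat_pow_eq
  induction i with
  | zero => exact hd
  | succ i ih =>
    rw [pow_succ', Equiv.Perm.mul_apply]
    exact hK _ (ih ⟨i, by simp⟩)

theorem card_edge_mul_two [Fintype D] : Nat.card T.Edge * 2 = Fintype.card D := by
  refine card_sameCycle_quotient_mul T.rev 2 fun d => ?_
  have : {x | T.rev.SameCycle d x} = {d, T.rev d} := by
    ext x
    constructor
    · intro hx
      refine sameCycle_subset_of_mapsTo T.rev (by simp) ?_ hx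
      rintro y (rfl | rfl) <;> simp [T.rev_rev]
    · rintro (rfl | rfl)
      · exact Equiv.Perm.SameCycle.refl _ _
      · exact ⟨1, by simp⟩
  rw [this, Set.ncard_pair (T.rev_ne d).symm]

theorem card_face_mul_three [Fintype D] : Nat.card T.Face * 3 = Fintype.card D := by
  refine card_sameCycle_quotient_mul T.nxt 3 fun d => ?_
  have : {x | T.nxt.SameCycle d x} = {d, T.nxt d, T.nxt (T.nxt d)} := by
    ext x
    constructor
    · intro hx
      refine sameCycle_subset_of_mapsTo T.nxt (by simp) ?_ hx
      rintro y (rfl | rfl | rfl) <;> simp [T.nxt_nxt_nxt]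
    · rintro (rfl | rfl | rfl)
      · exact Equiv.Perm.SameCycle.refl _ _
      · exact ⟨1, by simp⟩
      · exact ⟨2, by simp [pow_two]⟩
  rw [this, Set.ncard_eq_three]
  exact ⟨_, _, _, (T.nxt_ne d).symm, (T.nxt_nxt_ne d).symm,
    fun h => T.nxt_ne d (T.nxt.injective h).symm, rfl⟩

/-- With 2E = 3F = |D|, six times the Euler characteristic is 6V - |D|. -/
theorem six_mul_card_vert_lt [Fintype D] (h : T.eulerChar < 0) :
    6 * Nat.card T.Vert < Fintype.card D := by
  have h2 := T.card_edge_mul_two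
  have h3 := T.card_face_mul_three
  rw [eulerChar] at h
  omega

/-! ### Sign patterns on oriented edges -/

/-- Rotating backwards from any oriented edge one reaches every oriented edge with the same initial
vertex. -/
theorem exists_iterate_σ_inv [Finite D] {d x : D} (h : T.src d = T.src x) :
    ∃ j : ℕ, (T.σ⁻¹ : Equiv.Perm D)^[j] d = x := by
  have hc : T.σ.SameCycle d x := Quotient.exact h
  obtain ⟨j, hj⟩ := (Equiv.Perm.sameCycle_inv.mpr hc).exists_nat_pow_eq
  exact ⟨j, by rw [Equiv.Perm.iterate_eq_pow]; exact hj⟩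

/-- A sign function can be altered on `M` so that it changes just before every element of `M`. -/
theorem exists_alternating_on [Finite D] (M : Set D) (ε₀ : D → Bool)
    (hM : ∀ d ∈ M, ∃ x, T.src x = T.src d ∧ x ∉ M) :
    ∃ ε : D → Bool, (∀ d, d ∉ M → ε d = ε₀ d) ∧ ∀ d, T.σ d ∈ M → ε (T.σ d) = !ε d := by
  classical
  have hex : ∀ d, ∃ j : ℕ, (T.σ⁻¹ : Equiv.Perm D)^[j] d ∉ M := by
    intro d
    by_cases hd : d ∈ M
    · obtain ⟨x, hx, hxM⟩ := hM d hd
      obtain ⟨j, hj⟩ := T.exists_iterate_σ_inv hx.symm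
      exact ⟨j, by rwa [hj]⟩
    · exact ⟨0, hd⟩
  -- Rotate backwards to the nearest oriented edge outside `M`, take its sign and flip it once per
  -- step.
  refine ⟨fun d => (fun b : Bool => !b)^[Nat.find (hex d)]
    (ε₀ ((T.σ⁻¹ : Equiv.Perm D)^[Nat.find (hex d)] d)), ?_, ?_⟩
  · intro d hd
    have : Nat.find (hex d) = 0 := (Nat.find_eq_zero _).mpr hd
    simp only [this, Function.iterate_zero, id]
  · intro d hd
    have hinv : (T.σ⁻¹ : Equiv.Perm D) (T.σ d) = d := by simp
    have hex' : ∃ j : ℕ, (T.σ⁻¹ : Equiv.Perm D)^[j + 1] (T.σ d) ∉ M := by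
      obtain ⟨j, hj⟩ := hex d
      exact ⟨j, by rwa [Function.iterate_succ_apply, hinv]⟩
    have h1 : Nat.find (hex (T.σ d)) = Nat.find hex' + 1 :=
      Nat.find_comp_succ (hex (T.σ d)) hex' (by simpa using hd)
    simp only [h1, Function.iterate_succ_apply, hinv]
    rw [← Function.iterate_succ_apply (fun b : Bool => !b), Function.iterate_succ_apply']

/-- An antisymmetric sign function can be completed to an orientation of all edges. -/
theorem exists_orientation [Finite D] (s : D → SignType) (hs : ∀ d, s (T.rev d) = -s d) :
    ∃ ε : D → Bool, (∀ d, ε (T.rev d) = !ε d) ∧ (∀ d, ε d = true → 0 ≤ s d) ∧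
      ∀ d, ε d = false → s d ≤ 0 := by
  classical
  have := Fintype.ofFinite D
  let o := Fintype.equivFin D
  -- An enumeration of the oriented edges breaks the tie on edges of sign zero.
  refine ⟨fun d => decide (0 < s d ∨ (s d = 0 ∧ o d < o (T.rev d))), ?_, ?_, ?_⟩
  · intro d
    have hne : o d ≠ o (T.rev d) := fun h => T.rev_ne d (o.injective h).symm
    simp only [hs, T.rev_rev]
    rcases hsd : s d with _ | _ | _
    · rcases lt_or_gt_of_ne hne with h | h <;> simp [h, h.not_gt]
    · simp
    · simp
  · intro d hd
    simp only [decide_eq_true_eq] at hd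
    rcases hd with h | h
    · exact h.le
    · exact h.1.ge
  · intro d hd
    simp only [decide_eq_false_iff_not, not_or] at hd
    exact not_lt.mp hd.1

/-! ### Counting around a set of vertices -/

section Count

variable [Fintype D] (W : Set T.Vert)

open Classical in
/-- The oriented edges inside `W`. -/
noncomputable def innerDarts : Finset D := {d | T.src d ∈ W ∧ T.tgt d ∈ W}

open Classical in
/-- The oriented edges that leave `W`. -/
noncomputable def exitDarts : Finset D := {d | T.src d ∈ W ∧ T.tgt d ∉ W}

open Classical in
/-- The oriented edges on the left of which there is a face inside `W`. -/
noncomputable def faceDarts : Finset D := {d | d ∈ T.innerDarts W ∧ T.σ d ∈ T.innerDarts W}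

open Classical in
/-- The oriented edges inside `W` followed by one that leaves `W`. -/
noncomputable def lastInnerDarts : Finset D := {d | d ∈ T.innerDarts W ∧ T.σ d ∈ T.exitDarts W}

open Classical in
/-- The oriented edges that leave `W` followed by one that leaves `W`. -/
noncomputable def cornerDarts : Finset D := {d | d ∈ T.exitDarts W ∧ T.σ d ∈ T.exitDarts W}

variable {W} {T} {d : D}

theorem mem_innerDarts : d ∈ T.innerDarts W ↔ T.src d ∈ W ∧ T.tgt d ∈ W := by simp [innerDarts]

theorem mem_exitDarts : d ∈ T.exitDarts W ↔ T.src d ∈ W ∧ T.tgt d ∉ W := by simp [exitDarts]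

theorem mem_faceDarts : d ∈ T.faceDarts W ↔ d ∈ T.innerDarts W ∧ T.σ d ∈ T.innerDarts W := by
  simp [faceDarts]

theorem mem_lastInnerDarts :
    d ∈ T.lastInnerDarts W ↔ d ∈ T.innerDarts W ∧ T.σ d ∈ T.exitDarts W := by
  simp [lastInnerDarts]

theorem mem_cornerDarts : d ∈ T.cornerDarts W ↔ d ∈ T.exitDarts W ∧ T.σ d ∈ T.exitDarts W := by
  simp [cornerDarts]

theorem rev_mem_innerDarts (h : d ∈ T.innerDarts W) : T.rev d ∈ T.innerDarts W := by
  rw [mem_innerDarts] at h ⊢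
  rw [T.src_rev, T.tgt_rev]
  exact h.symm

theorem nxt_mem_faceDarts (h : d ∈ T.faceDarts W) : T.nxt d ∈ T.faceDarts W := by
  simp only [mem_faceDarts, mem_innerDarts, T.src_nxt, T.tgt_nxt, T.σ_nxt, T.src_rev, T.tgt_rev,
    T.src_σ] at h ⊢
  tauto

/-- When the next edge stays in `W`, the triangle on the left of `d` has a second vertex in `W`,
from which another side runs to the endpoint of `d`. -/
theorem rev_nxt_mem_exitDarts (h : d ∈ T.exitDarts W) (h' : d ∉ T.cornerDarts W) :
    T.rev (T.nxt d) ∈ T.exitDarts W := by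
  simp only [mem_cornerDarts, mem_exitDarts, T.src_nxt, T.tgt_nxt, T.src_rev, T.tgt_rev,
    T.src_σ] at h h' ⊢
  tauto

theorem σ_mem_innerDarts (h : d ∈ T.exitDarts W) (h' : d ∉ T.cornerDarts W) :
    T.σ d ∈ T.innerDarts W := by
  simp only [mem_cornerDarts, mem_exitDarts, mem_innerDarts, T.src_σ] at h h' ⊢
  tauto

variable (T) (W)

/-- Inner edges are classified by their successor in the rotation. -/
theorem card_innerDarts :
    (T.innerDarts W).card = (T.faceDarts W).card + (T.lastInnerDarts W).card := by
  classical
  rw [← Finset.card_union_of_disjoint]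
  · congr 1
    ext d
    simp only [Finset.mem_union, mem_faceDarts, mem_lastInnerDarts, mem_innerDarts, mem_exitDarts,
      T.src_σ]
    tauto
  · rw [Finset.disjoint_left]
    intro d h h'
    exact (mem_exitDarts.mp (mem_lastInnerDarts.mp h').2).2
      (mem_innerDarts.mp (mem_faceDarts.mp h).2).2

/-- Leaving edges are classified by their predecessor, hence the shift by σ⁻¹. -/
theorem card_exitDarts :
    (T.exitDarts W).card = (T.lastInnerDarts W).card + (T.cornerDarts W).card := by
  classical
  rw [← Finset.card_union_of_disjoint, ← Finset.card_map T.σ.symm.toEmbedding]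
  · congr 1
    ext d
    simp only [Finset.mem_map_equiv, Finset.mem_union, mem_cornerDarts, mem_lastInnerDarts,
      mem_innerDarts, mem_exitDarts, Equiv.symm_symm, T.src_σ]
    tauto
  · rw [Finset.disjoint_left]
    intro d h h'
    exact (mem_exitDarts.mp (mem_cornerDarts.mp h').1).2
      (mem_innerDarts.mp (mem_lastInnerDarts.mp h).1).2

/-- Each face inside `W` has a corner at which the orientation changes. -/
theorem card_faceDarts_le {ε : D → Bool}
    (hε : ∀ d ∈ T.innerDarts W, ε (T.rev d) = !ε d) :
    (T.faceDarts W).card ≤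
      3 * ((T.faceDarts W).filter fun d => ε d ≠ ε (T.σ d)).card := by
  classical
  set C := (T.faceDarts W).filter fun d => ε d ≠ ε (T.σ d) with hC
  have hsub : T.faceDarts W ⊆ C ∪ (C.image T.nxt ∪ C.image (fun d => T.nxt (T.nxt d))) := by
    intro d hd
    have h1 := nxt_mem_faceDarts hd
    have h2 := nxt_mem_faceDarts h1
    -- A change at a corner means that its two sides run the same way round the face. Of the three
    -- sides of a face, two always do.
    have mem : ∀ {x}, x ∈ T.faceDarts W → (x ∈ C ↔ ε x = ε (T.nxt (T.nxt x))) := by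
      intro x hx
      have h3 := hε _ (mem_faceDarts.mp (nxt_mem_faceDarts (nxt_mem_faceDarts hx))).1
      rw [T.rev_nxt_nxt] at h3
      simp only [hC, Finset.mem_filter, hx, true_and, h3, ne_eq]
      cases ε x <;> cases ε (T.nxt (T.nxt x)) <;> simp
    have key : d ∈ C ∨ T.nxt d ∈ C ∨ T.nxt (T.nxt d) ∈ C := by
      rw [mem hd, mem h1, mem h2]
      simp only [T.nxt_nxt_nxt]
      cases ε d <;> cases ε (T.nxt d) <;> cases ε (T.nxt (T.nxt d)) <;> simp
    simp only [Finset.mem_union, Finset.mem_image]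
    rcases key with h | h | h
    · exact Or.inl h
    · exact Or.inr (Or.inr ⟨_, h, T.nxt_nxt_nxt d⟩)
    · exact Or.inr (Or.inl ⟨_, h, T.nxt_nxt_nxt d⟩)
  have c0 := Finset.card_le_card hsub
  have c1 := Finset.card_union_le C (C.image T.nxt ∪ C.image (fun d => T.nxt (T.nxt d)))
  have c2 := Finset.card_union_le (C.image T.nxt) (C.image (fun d => T.nxt (T.nxt d)))
  have c3 : (C.image T.nxt).card ≤ C.card := Finset.card_image_le
  have c4 : (C.image (fun d => T.nxt (T.nxt d))).card ≤ C.card := Finset.card_image_le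
  omega

open Classical in
-- Changes before leaving edges and changes at corners of inner faces are distinct, and there are at
-- most two changes per vertex of `W`. `T.faceDarts W` counts each face three times.
theorem three_mul_card_exitDarts_add_le {ε : D → Bool}
    (hε : ∀ d ∈ T.innerDarts W, ε (T.rev d) = !ε d)
    (hexit : ∀ d, T.σ d ∈ T.exitDarts W → ε (T.σ d) = !ε d)
    (htwo : ∀ v ∈ W, (Finset.univ.filter fun d => T.src d = v ∧ ε d ≠ ε (T.σ d)).card ≤ 2) :
    3 * (T.exitDarts W).card + (T.faceDarts W).card ≤ 6 * W.ncard := by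
  set C := Finset.univ.filter fun d => T.src d ∈ W ∧ ε d ≠ ε (T.σ d) with hC
  have hle : C.card ≤ 2 * W.toFinite.toFinset.card := by
    refine Finset.card_le_mul_card_image_of_maps_to (f := T.src)
      (fun d hd => by simpa using (Finset.mem_filter.mp hd).2.1) 2 ?_
    intro v hv
    refine le_trans (Finset.card_le_card ?_) (htwo v (by simpa using hv))
    intro d
    simp only [hC, Finset.mem_filter, Finset.mem_univ, true_and]
    tauto
  rw [← Set.ncard_eq_toFinset_card] at hle
  set C₃ := (T.faceDarts W).filter fun d => ε d ≠ ε (T.σ d) with hC₃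
  have h3 := T.card_faceDarts_le W hε
  rw [← hC₃] at h3
  have hsub : (T.exitDarts W).map T.σ.symm.toEmbedding ∪ C₃ ⊆ C := by
    intro d
    simp only [Finset.mem_union, Finset.mem_map_equiv, Equiv.symm_symm, hC, hC₃,
      Finset.mem_filter, Finset.mem_univ, true_and]
    rintro (h | h)
    · refine ⟨?_, ?_⟩
      · rw [← T.src_σ]
        exact (mem_exitDarts.mp h).1
      · rw [hexit d h]
        simp
    · exact ⟨(mem_innerDarts.mp (mem_faceDarts.mp h.1).1).1, h.2⟩
  have hdisj : Disjoint ((T.exitDarts W).map T.σ.symm.toEmbedding) C₃ := by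
    rw [Finset.disjoint_left]
    intro d h h'
    simp only [Finset.mem_map_equiv, Equiv.symm_symm, hC₃, Finset.mem_filter] at h h'
    exact (mem_exitDarts.mp h).2 (mem_innerDarts.mp (mem_faceDarts.mp h'.1).2).2
  have := Finset.card_le_card hsub
  rw [Finset.card_union_of_disjoint hdisj, Finset.card_map] at this
  omega

/-- If the edges outside `W` next to the faces with a single vertex in `W` are matched, then the
whole surface is covered by `W` and the faces that meet `W`. -/
theorem card_le_of_matched (hne : W.Nonempty)
    (h : ∀ d ∈ T.cornerDarts W, ∃ d' ∈ T.cornerDarts W, T.nxt d = T.rev (T.nxt d')) :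
    Fintype.card D ≤
      (T.innerDarts W).card + 2 * (T.exitDarts W).card + (T.cornerDarts W).card := by
  classical
  let K : Finset D := (T.innerDarts W ∪ T.exitDarts W) ∪
    ((T.exitDarts W).image T.rev ∪ (T.cornerDarts W).image T.nxt)
  have hK : ∀ {d}, d ∈ K ↔ T.src d ∈ W ∨ (∃ x ∈ T.exitDarts W, T.rev x = d) ∨
      ∃ x ∈ T.cornerDarts W, T.nxt x = d := by
    intro d
    simp only [K, Finset.mem_union, Finset.mem_image, mem_innerDarts, ← and_or_left,
      mem_exitDarts (d := d), em, and_true]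
  -- Clockwise rotation can leave the star of `W` only across the side opposite to a corner, and
  -- there the matching brings it back.
  have hinv : ∀ d ∈ (K : Set D), (T.σ⁻¹ : Equiv.Perm D) d ∈ (K : Set D) := by
    intro d hd
    rw [Finset.mem_coe, hK] at hd ⊢
    rcases hd with hd | ⟨x, hx, rfl⟩ | ⟨x, hx, rfl⟩
    · rw [T.src_σ_inv]
      exact Or.inl hd
    · change _ ∨ (∃ y ∈ _, _ = T.nxt x) ∨ (∃ y ∈ _, _ = T.nxt x)
      by_cases hc : x ∈ T.cornerDarts W
      · exact Or.inr (Or.inr ⟨x, hc, rfl⟩)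
      · exact Or.inr (Or.inl ⟨_, rev_nxt_mem_exitDarts hx hc, T.rev_rev _⟩)
    · obtain ⟨x', hx', hxx'⟩ := h x hx
      refine Or.inr (Or.inl ⟨T.σ x', (mem_cornerDarts.mp hx').2, ?_⟩)
      rw [hxx', T.rev_σ]
      rfl
  have hrev : ∀ d ∈ (K : Set D), T.rev d ∈ (K : Set D) := by
    intro d hd
    rw [Finset.mem_coe, hK] at hd ⊢
    rcases hd with hd | ⟨x, hx, rfl⟩ | ⟨x, hx, rfl⟩
    · by_cases ht : T.tgt d ∈ W
      · exact Or.inl ht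
      · exact Or.inr (Or.inl ⟨d, mem_exitDarts.mpr ⟨hd, ht⟩, rfl⟩)
    · rw [T.rev_rev]
      exact Or.inl (mem_exitDarts.mp hx).1
    · obtain ⟨x', hx', hxx'⟩ := h x hx
      rw [hxx', T.rev_rev]
      exact Or.inr (Or.inr ⟨x', hx', rfl⟩)
  have hσ : ∀ d ∈ (K : Set D), T.σ d ∈ (K : Set D) := by
    intro d hd
    rw [mem_iff_of_mapsTo _ hinv]
    simpa using hd
  have huniv : (K : Set D) = Set.univ := by
    refine T.eq_univ_of_closed ?_ hσ hrev
    obtain ⟨v, hv⟩ := hne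
    obtain ⟨d, rfl⟩ := Quotient.exists_rep v
    exact ⟨d, Finset.mem_coe.mpr (hK.mpr (Or.inl hv))⟩
  rw [Finset.coe_eq_univ] at huniv
  rw [← Finset.card_univ, ← huniv]
  have c1 := Finset.card_union_le (T.innerDarts W ∪ T.exitDarts W)
    ((T.exitDarts W).image T.rev ∪ (T.cornerDarts W).image T.nxt)
  have c2 := Finset.card_union_le (T.innerDarts W) (T.exitDarts W)
  have c3 := Finset.card_union_le ((T.exitDarts W).image T.rev) ((T.cornerDarts W).image T.nxt)
  have c4 : ((T.exitDarts W).image T.rev).card ≤ _ := Finset.card_image_le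
  have c5 : ((T.cornerDarts W).image T.nxt).card ≤ _ := Finset.card_image_le
  change (_ ∪ _ : Finset D).card ≤ _
  omega

/-! ### Lifting the boundary of a simply connected set of vertices -/

variable {T} {W} {x₀ : T.Vert}

/-- Two sides of a triangle with a common endpoint outside `W` still end at one point upstairs,
because the third side lifts with `L`. -/
theorem tgt_liftDart_rev_nxt {L : T.Vert → T.UVert x₀} (hL : ∀ v, (L v).1 = v)
    (hlift : T.IsLiftOn L (T.innerDarts W)) (hd : T.σ d ∈ T.innerDarts W) :
    (liftDart hL (T.rev (T.nxt d))).tgt = (liftDart hL d).tgt := by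
  have h1 : (liftDart hL (T.σ d)).tgt = L (T.tgt (T.σ d)) := hlift _ hd rfl
  have h2 : liftDart hL (T.rev (T.nxt d)) = (liftDart hL d).nxt.rev := by
    refine UDart.ext ?_ rfl
    change L (T.tgt (T.nxt d)) = (liftDart hL d).nxt.tgt
    rw [tgt_nxt_liftDart, h1, T.tgt_nxt]
  rw [h2, UDart.tgt_rev]
  rfl

/-- Turning around the endpoint of an edge that leaves `W` one meets another corner. -/
theorem exists_corner_with_same_tgt {L : T.Vert → T.UVert x₀} (hL : ∀ v, (L v).1 = v)
    (hlift : T.IsLiftOn L (T.innerDarts W)) (hd : d ∈ T.cornerDarts W) :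
    ∃ d' ∈ T.cornerDarts W, (liftDart hL d').tgt = (liftDart hL (T.σ d)).tgt := by
  by_contra! hno
  -- Without such a corner, clockwise rotation about the endpoint of `T.σ d` meets only reversed
  -- leaving edges. A full turn would then reach the side opposite to the corner `d`, which does not
  -- start in `W`.
  have hturn : ∀ j : ℕ, ∃ m ∈ T.exitDarts W, (liftDart hL m).tgt = (liftDart hL (T.σ d)).tgt ∧
      T.rev m = (T.σ⁻¹ : Equiv.Perm D)^[j] (T.rev (T.σ d)) := by
    intro j
    induction j with
    | zero => exact ⟨T.σ d, (mem_cornerDarts.mp hd).2, rfl, rfl⟩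
    | succ j ih =>
      obtain ⟨m, hm, hmt, hmj⟩ := ih
      have hmc : m ∉ T.cornerDarts W := fun h => hno m h hmt
      refine ⟨T.rev (T.nxt m), rev_nxt_mem_exitDarts hm hmc, ?_, ?_⟩
      · rw [tgt_liftDart_rev_nxt hL hlift (σ_mem_innerDarts hm hmc), hmt]
      · rw [Function.iterate_succ_apply', ← hmj, T.rev_rev]
        rfl
  obtain ⟨j, hj⟩ := T.exists_iterate_σ_inv (d := T.rev (T.σ d)) (x := T.σ (T.rev (T.σ d)))
    (T.src_σ _).symm
  obtain ⟨m, hm, -, hmj⟩ := hturn j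
  rw [hj, T.rev_σ, T.σ_nxt] at hmj
  have := T.rev.injective hmj
  subst this
  have h1 := (mem_exitDarts.mp hm).1
  rw [T.src_nxt] at h1
  exact (mem_exitDarts.mp (mem_cornerDarts.mp hd).1).2 h1

/-- Follow corners along common lifted endpoints. The absence of loops makes consecutive corners
distinct, so with at most two corners the second step returns to `d`. The two opposite sides then
have the same endpoints upstairs, so they coincide up to reversal. -/
theorem matched_of_lift (hT : T.QuasiSimplicial x₀) {L : T.Vert → T.UVert x₀}
    (hL : ∀ v, (L v).1 = v) (hlift : T.IsLiftOn L (T.innerDarts W))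
    (hcard : (T.cornerDarts W).card ≤ 2) :
    ∀ d ∈ T.cornerDarts W, ∃ d' ∈ T.cornerDarts W, T.nxt d = T.rev (T.nxt d') := by
  classical
  have hloop : ∀ d, (liftDart hL d).tgt ≠ (liftDart hL (T.σ d)).tgt := by
    intro d h
    rw [← tgt_nxt_liftDart] at h
    exact hT.1 (liftDart hL d).nxt h.symm
  intro d hd
  obtain ⟨d', hd', h'⟩ := exists_corner_with_same_tgt hL hlift hd
  obtain ⟨d'', hd'', h''⟩ := exists_corner_with_same_tgt hL hlift hd'
  have n1 : d ≠ d' := by rintro rfl; exact hloop d h'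
  have n2 : d' ≠ d'' := by rintro rfl; exact hloop d' h''
  have n3 : d'' = d := by
    by_contra hne
    have hsub : ({d, d', d''} : Finset D) ⊆ T.cornerDarts W := by
      simp [Finset.insert_subset_iff, hd, hd', hd'']
    have := Finset.card_le_card hsub
    rw [Finset.card_eq_three.mpr ⟨d, d', d'', n1, Ne.symm hne, n2, rfl⟩] at this
    omega
  subst n3
  refine ⟨d', hd', ?_⟩
  have : (liftDart hL d'').nxt = (liftDart hL d').nxt.rev := by
    refine hT.2 _ _ ?_ ?_
    · change (liftDart hL d'').tgt = (liftDart hL d').nxt.tgt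
      rw [tgt_nxt_liftDart, h'']
    · rw [UDart.tgt_rev, tgt_nxt_liftDart, ← h']
      rfl
  exact congrArg UDart.dart this

end Count

/-! ### Vanishing of sign patterns -/

/-- On a quasi-simplicial triangulation of negative Euler characteristic, an antisymmetric sign
function on oriented edges vanishes, if at each vertex where it does not vanish every completion
of it has at most two sign changes. -/
theorem sign_eq_zero [Fintype D] [DecidableEq T.Vert] (hχ : T.eulerChar < 0) {x₀ : T.Vert}
    (hT : T.QuasiSimplicial x₀) {s : D → SignType} (hs : ∀ d, s (T.rev d) = -s d)
    (htwo : ∀ (ε : D → Bool) (d₀ : D), s d₀ ≠ 0 →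
      (∀ d, T.src d = T.src d₀ → (ε d = true → 0 ≤ s d) ∧ (ε d = false → s d ≤ 0)) →
      (Finset.univ.filter fun d => T.src d = T.src d₀ ∧ ε d ≠ ε (T.σ d)).card ≤ 2)
    (d : D) : s d = 0 := by
  classical
  by_contra hd
  have hcard := T.six_mul_card_vert_lt hχ
  let supp : Set T.Vert := {v | ∃ x, T.src x = v ∧ s x ≠ 0}
  let r : T.Vert → T.Vert → Prop := fun v w => ∃ x, T.src x = v ∧ T.tgt x = w ∧ w ∈ supp
  let W : Set T.Vert := {v | Relation.ReflTransGen r (T.src d) v}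
  have hdW : T.src d ∈ W := Relation.ReflTransGen.refl
  have hWsupp : W ⊆ supp := by
    intro v hv
    rcases Relation.ReflTransGen.cases_tail hv with rfl | ⟨_, _, _, _, _, h⟩
    · exact ⟨d, rfl, hd⟩
    · exact h
  have hexit : ∀ x ∈ T.exitDarts W, s x = 0 := by
    intro x hx
    obtain ⟨h1, h2⟩ := mem_exitDarts.mp hx
    by_contra hne
    refine h2 (h1.tail ⟨x, rfl, rfl, T.rev x, rfl, ?_⟩)
    rw [hs]
    simpa using hne
  obtain ⟨ε₀, hε₀, hpos, hneg⟩ := T.exists_orientation s hs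
  obtain ⟨ε, hε, halt⟩ := T.exists_alternating_on (T.exitDarts W : Set D) ε₀ (by
    intro x hx
    obtain ⟨y, hy, hsy⟩ := hWsupp (mem_exitDarts.mp hx).1
    exact ⟨y, hy, fun h => hsy (hexit y h)⟩)
  have hinner : ∀ x ∈ T.innerDarts W, ε x = ε₀ x := fun x hx =>
    hε x fun h => (mem_exitDarts.mp h).2 (mem_innerDarts.mp hx).2
  have hmain := T.three_mul_card_exitDarts_add_le W (ε := ε)
    (by
      intro x hx
      rw [hinner x hx, hinner _ (rev_mem_innerDarts hx), hε₀])
    (fun x hx => halt x hx)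
    (by
      intro v hv
      obtain ⟨y, rfl, hsy⟩ := hWsupp hv
      convert htwo ε y hsy ?_
      intro x hx
      by_cases hxe : x ∈ T.exitDarts W
      · rw [hexit x hxe]
        simp
      · rw [hε x hxe]
        exact ⟨hpos x, hneg x⟩)
  have hA := T.card_innerDarts W
  have hM := T.card_exitDarts W
  have hmatched : ∀ d ∈ T.cornerDarts W, ∃ d' ∈ T.cornerDarts W, T.nxt d = T.rev (T.nxt d') := by
    intro d₁ hd₁
    have hcpos : 0 < (T.cornerDarts W).card := Finset.card_pos.mpr ⟨d₁, hd₁⟩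
    have hWc := Set.ncard_eq_toFinset_card W
    -- With c corners, `hmain`, `hA` and `hM` give 6χ ≥ 3c for the subcomplex on `W`. Thus c > 0
    -- makes χ positive, and then 6χ ≤ 6 gives c ≤ 2.
    obtain ⟨h1, L, hL, hlift⟩ := T.exists_lift_of_complex x₀ (W := W.toFinite.toFinset)
      (w₀ := T.src d) ((Set.Finite.mem_toFinset _).mpr hdW) (A := T.innerDarts W) (Φ := T.faceDarts W)
      (fun x hx => rev_mem_innerDarts hx)
      (fun x hx => (Set.Finite.mem_toFinset _).mpr (mem_innerDarts.mp hx).1)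
      (by
        intro B hB hdB hclosed
        refine le_antisymm hB fun v hv => ?_
        have hv' : Relation.ReflTransGen r (T.src d) v := by simpa [W] using hv
        clear hv
        induction hv' with
        | refl => exact hdB
        | tail hab hbc ih =>
          obtain ⟨x, rfl, rfl, hx⟩ := hbc
          exact hclosed x (mem_innerDarts.mpr ⟨hab, hab.tail ⟨x, rfl, rfl, hx⟩⟩) ih)
      (fun x hx => (mem_faceDarts.mp hx).1)
      (fun x hx => nxt_mem_faceDarts hx)
      (by
        intro h
        have h1 : d₁ ∈ T.faceDarts W := h ▸ Finset.mem_univ d₁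
        exact (mem_exitDarts.mp (mem_cornerDarts.mp hd₁).1).2
          (mem_innerDarts.mp (mem_faceDarts.mp h1).1).2)
      (by omega)
    exact matched_of_lift hT hL hlift (by omega) d₁ hd₁
  -- By `hA` and `hM` this bound on |D| equals the left side of `hmain`, so |D| ≤ 6|W|.
  have htotal := T.card_le_of_matched W ⟨_, hdW⟩ hmatched
  have hWle : W.ncard ≤ Nat.card T.Vert := Set.ncard_le_card W
  omega

end OrientedTriangulation

namespace OrientedTriangulation

variable {D : Type*} {T : OrientedTriangulation D} {x₀ : T.Vert}

/-! ### Deck transformations -/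

/-- The deck transformation is the loop that follows one lifting path and returns along the other.
-/
theorem UDart.exists_deck {e e' : T.UDart x₀} (h : e.dart = e'.dart) :
    ∃ γ : T.FundGroup x₀, e'.src = γ • e.src ∧ e'.tgt = γ • e.tgt := by
  obtain ⟨⟨v, c⟩, d, hd⟩ := e
  obtain ⟨⟨v', c'⟩, d', hd'⟩ := e'
  obtain rfl : d = d' := h
  obtain rfl : T.src d = v := hd
  obtain rfl : T.src d = v' := hd'
  have hc : (c'.comp c.symm).comp c = c' := by
    rw [PathClass.comp_assoc, PathClass.symm_comp, PathClass.comp_nil]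
  refine ⟨c'.comp c.symm, Sigma.ext rfl (heq_of_eq hc.symm), Sigma.ext rfl (heq_of_eq ?_)⟩
  change c'.comp _ = (c'.comp c.symm).comp (c.comp _)
  rw [← PathClass.comp_assoc, hc]

/-! ### Signs of infinitesimal motions of circle packings -/

variable {ρ : T.FundGroup x₀ →* PSL(2, ℂ)} {S : T.UVert x₀ → deSitter}

namespace InPackingLocus

theorem add_ne_zero (hS : T.InPackingLocus ρ S) (e : T.UDart x₀) :
    (S e.src : Matrix (Fin 2) (Fin 2) ℂ) + (S e.tgt : Matrix (Fin 2) (Fin 2) ℂ) ≠ 0 :=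
  ne_zero_of_not_neg (hS.not_neg e)

theorem exists_isTangencyPoint (hS : T.InPackingLocus ρ S) (e : T.UDart x₀) :
    ∃ p, IsTangencyPoint (S e.src) (S e.tgt) p := by
  obtain ⟨B, θ, -, -, -, h⟩ := hS.cyclicOrder e
  exact ⟨_, h 0⟩

/-- The tangency points around a vertex, in a coordinate in which its disk is the unit disk. -/
theorem exists_tangency_data (hS : T.InPackingLocus ρ S) (e : T.UDart x₀) :
    ∃ (B : SL(2, ℂ)) (θ : ℕ → ℝ) (z : ℕ → Fin 2 → ℂ), StrictMono θ ∧
      (∀ i, θ (i + Function.minimalPeriod T.σ e.dart) = θ i + 2 * Real.pi) ∧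
      (∀ i, z i ≠ 0 ∧ ((S e.src : Matrix (Fin 2) (Fin 2) ℂ) +
        (S (UDart.rot^[i] e).tgt : Matrix (Fin 2) (Fin 2) ℂ)) *ᵥ
        star (z i) = 0) ∧
      ∀ A : Matrix (Fin 2) (Fin 2) ℂ, A.trace = 0 → ∀ i, outwardRate (S e.src) A (z i) =
        trigLinear (2 * (adjAct (QuotientGroup.mk B) A 0 0).re)
          ((adjAct (QuotientGroup.mk B) A 0 1).re - (adjAct (QuotientGroup.mk B) A 1 0).re)
          ((adjAct (QuotientGroup.mk B) A 0 1).im + (adjAct (QuotientGroup.mk B) A 1 0).im)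
          (θ i) := by
  obtain ⟨B, θ, hB, hθ, hper, htan⟩ := hS.cyclicOrder e
  induction B using QuotientGroup.induction_on with
  | H B =>
  have hBB : (B : Matrix (Fin 2) (Fin 2) ℂ) * ((B⁻¹ : SL(2, ℂ)) : Matrix (Fin 2) (Fin 2) ℂ) = 1 := by
    rw [← Matrix.SpecialLinearGroup.coe_mul]; simp
  let v : ℕ → Fin 2 → ℂ := fun i => ![Complex.exp (θ i * Complex.I), 1]
  have hv : ∀ i, v i ≠ 0 := fun i h => by simpa [v] using congrFun h 1
  let z : ℕ → Fin 2 → ℂ := fun i => ((B⁻¹ : SL(2, ℂ)) : Matrix (Fin 2) (Fin 2) ℂ) *ᵥ v i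
  have hBz : ∀ i, (B : Matrix (Fin 2) (Fin 2) ℂ) *ᵥ z i = v i := by
    intro i
    simp only [z]
    rw [Matrix.mulVec_mulVec, hBB, Matrix.one_mulVec]
  have hz : ∀ i, z i ≠ 0 := by
    intro i h
    apply hv i
    rw [← hBz, h, Matrix.mulVec_zero]
  refine ⟨B, θ, z, hθ, hper, fun i => ⟨hz i, ?_⟩, ?_⟩
  · have hp := htan i
    have hp' : (QuotientGroup.mk B : PSL(2, ℂ))⁻¹ • circlePoint (θ i) =
        Projectivization.mk ℂ (z i) (hz i) := rfl
    rw [hp'] at hp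
    have hsrc := UDart.src_rot_iterate e i
    rw [← hsrc] at hp
    have h0 := hp.mulVec_star_eq_zero (S _).2 (S _).2 (hS.mink_eq _) (hS.not_neg _)
    obtain ⟨a, ha⟩ := Projectivization.exists_smul_eq_mk_rep ℂ (z i) (hz i)
    rw [← ha, Units.smul_def, star_smul, Matrix.mulVec_smul] at h0
    rw [← hsrc]
    exact (smul_eq_zero.mp h0).resolve_left (by simp)
  · intro A hA i
    have htr : (adjAct (QuotientGroup.mk B) A).trace = 0 := by
      change ((B : Matrix (Fin 2) (Fin 2) ℂ) * A *
        ((B⁻¹ : SL(2, ℂ)) : Matrix (Fin 2) (Fin 2) ℂ)).trace = 0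
      rw [Matrix.trace_mul_comm, ← Matrix.mul_assoc, ← Matrix.SpecialLinearGroup.coe_mul,
        inv_mul_cancel, Matrix.SpecialLinearGroup.coe_one, Matrix.one_mul, hA]
    rw [← outwardRate_conj B, hBz, hB, outwardRate_unitCircle _ htr, trigLinear]

theorem minimalPeriod_pos [Finite D] (d : D) : 0 < Function.minimalPeriod T.σ d :=
  Function.minimalPeriod_pos_of_mem_periodicPts
    (Function.Injective.mem_periodicPts T.σ.injective d)

theorem two_lt_minimalPeriod [Finite D] (d : D) : 2 < Function.minimalPeriod T.σ d := by
  have h0 := minimalPeriod_pos (T := T) d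
  have hk := Function.iterate_minimalPeriod (f := T.σ) (x := d)
  by_contra! h
  interval_cases Function.minimalPeriod T.σ d
  · exact T.valence_ne_one d hk
  · exact T.valence_ne_two d hk

variable {P : T.UVert x₀ → Matrix (Fin 2) (Fin 2) ℂ}

/-- The rate is invariant under simultaneous conjugation, and the kernel vector is unique up to a
scalar c, which multiplies the rate by |c|² > 0; hence only the sign descends. -/
theorem exists_sign [Finite D] (hS : T.InPackingLocus ρ S)
    (hP : ∀ (γ : T.FundGroup x₀) α, P (γ • α) = adjAct (ρ γ) (P α)) :
    ∃ s : D → SignType, ∀ (e : T.UDart x₀) (z : Fin 2 → ℂ), z ≠ 0 →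
      ((S e.src : Matrix (Fin 2) (Fin 2) ℂ) + (S e.tgt : Matrix (Fin 2) (Fin 2) ℂ)) *ᵥ
        star z = 0 →
      SignType.sign (outwardRate (S e.src) (P e.src) z) = s e.dart := by
  let e₀ : D → T.UDart x₀ := fun d => ⟨⟨T.src d, (T.nonempty_pathClass x₀ _).some⟩, d, rfl⟩
  choose p hp using hS.exists_isTangencyPoint
  refine ⟨fun d => SignType.sign (outwardRate (S (e₀ d).src) (P (e₀ d).src) (p (e₀ d)).rep), ?_⟩
  intro e z hz hKz
  obtain ⟨γ, hsrc, htgt⟩ := UDart.exists_deck (e := e₀ e.dart) (e' := e) rfl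
  set f := e₀ e.dart with hf
  have h0 := (hp f).mulVec_star_eq_zero (S _).2 (S _).2 (hS.mink_eq _) (hS.not_neg _)
  have hS1 := hS.equivariant γ f.src
  have hS2 := hS.equivariant γ f.tgt
  have hP1 := hP γ f.src
  rw [← hsrc] at hS1 hP1
  rw [← htgt] at hS2
  generalize ρ γ = B at hS1 hS2 hP1
  induction B using QuotientGroup.induction_on with
  | H B =>
  have hBB : ((B⁻¹ : SL(2, ℂ)) : Matrix (Fin 2) (Fin 2) ℂ) * B = 1 := by
    rw [← Matrix.SpecialLinearGroup.coe_mul]; simp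
  have hw : (B : Matrix (Fin 2) (Fin 2) ℂ) *ᵥ (p f).rep ≠ 0 := by
    intro h
    apply (p f).rep_nonzero
    rw [← Matrix.one_mulVec (p f).rep, ← hBB, ← Matrix.mulVec_mulVec, h, Matrix.mulVec_zero]
  have hKw : ((S e.src : Matrix (Fin 2) (Fin 2) ℂ) + (S e.tgt : Matrix (Fin 2) (Fin 2) ℂ)) *ᵥ
      star ((B : Matrix (Fin 2) (Fin 2) ℂ) *ᵥ (p f).rep) = 0 := by
    rw [hS1, hS2, Matrix.add_mulVec, hermAct_mulVec_star, hermAct_mulVec_star, ← Matrix.mulVec_add,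
      ← Matrix.add_mulVec, h0, Matrix.mulVec_zero]
  obtain ⟨c, hc, rfl⟩ := exists_smul_of_mulVec_star_eq_zero (hS.add_ne_zero e) hw hz hKw hKz
  rw [sign_outwardRate_smul _ _ hc, hS1, hP1, outwardRate_conj]

/-- An equivariant infinitesimal motion that moves each tangency point in a single direction is
tangent to all circles of the packing. -/
theorem outwardRate_eq_zero [Finite D] (hS : T.InPackingLocus ρ S) (hχ : T.eulerChar < 0)
    (hT : T.QuasiSimplicial x₀) (htr : ∀ α, (P α).trace = 0)
    (hP : ∀ (γ : T.FundGroup x₀) α, P (γ • α) = adjAct (ρ γ) (P α))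
    (hv : ∀ (e : T.UDart x₀) (p : CP1), IsTangencyPoint (S e.src) (S e.tgt) p →
      (P e.tgt *ᵥ p.rep) 0 * p.rep 1 - p.rep 0 * (P e.tgt *ᵥ p.rep) 1 =
        (P e.src *ᵥ p.rep) 0 * p.rep 1 - p.rep 0 * (P e.src *ᵥ p.rep) 1)
    (e : T.UDart x₀) {z : Fin 2 → ℂ} (hz : z ≠ 0)
    (hKz : ((S e.src : Matrix (Fin 2) (Fin 2) ℂ) + (S e.tgt : Matrix (Fin 2) (Fin 2) ℂ)) *ᵥ
      star z = 0) :
    outwardRate (S e.src) (P e.src) z = 0 := by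
  classical
  have := Fintype.ofFinite D
  obtain ⟨s, hs⟩ := hS.exists_sign hP
  suffices h : s e.dart = 0 by rwa [← hs e z hz hKz, sign_eq_zero_iff] at h
  have hlift : ∀ d, ∃ e : T.UDart x₀, e.dart = d := fun d =>
    ⟨⟨⟨T.src d, (T.nonempty_pathClass x₀ _).some⟩, d, rfl⟩, rfl⟩
  refine T.sign_eq_zero hχ hT ?_ ?_ e.dart
  · intro d
    obtain ⟨e, rfl⟩ := hlift d
    obtain ⟨p, hp⟩ := hS.exists_isTangencyPoint e
    have hK := hp.mulVec_star_eq_zero (S _).2 (S _).2 (hS.mink_eq _) (hS.not_neg _)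
    have hform := hp.form_eq_zero (S _).2 (S _).2 (hS.mink_eq _) (hS.not_neg _)
    have h1 := hs e p.rep p.rep_nonzero hK
    have h2 := hs e.rev p.rep p.rep_nonzero (by
      rw [UDart.tgt_rev, add_comm]
      exact hK)
    change _ = s (T.rev e.dart) at h2
    rw [← h1, ← h2, ← outwardRate_eq_of_wedge_eq p.rep_nonzero hform (hv e p hp), ← Left.sign_neg]
    congr 1
    -- Antisymmetry: at the tangency vector the two Hermitian matrices take opposite values.
    change outwardRate (S e.tgt) (P e.tgt) _ = _
    rw [Matrix.add_mulVec] at hK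
    rw [outwardRate, outwardRate, eq_neg_of_add_eq_zero_right hK, dotProduct_neg, Complex.neg_re]
  · intro ε d₀ hd₀ hε
    obtain ⟨e, rfl⟩ := hlift d₀
    obtain ⟨B, θ, z, hθ, hper, hz, htrig⟩ := hS.exists_tangency_data e
    have hsign : ∀ i, s (T.σ^[i] e.dart) = SignType.sign _ := fun i => by
      have h := hs (UDart.rot^[i] e) (z i) (hz i).1 (by
        rw [UDart.src_rot_iterate]
        exact (hz i).2)
      rw [UDart.src_rot_iterate, UDart.dart_rot_iterate, htrig _ (htr _)] at h
      exact h.symm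
    have hsrc : ∀ i, T.src (T.σ^[i] e.dart) = T.src e.dart := by
      intro i
      rw [← UDart.dart_rot_iterate, (UDart.rot^[i] e).src_dart, UDart.src_rot_iterate, e.src_dart]
    have hcount := card_changes_le_two (ε := fun i => ε (T.σ^[i] e.dart)) hθ hper
      ⟨0, fun h => hd₀ (by
        have := hsign 0
        rwa [h, sign_zero] at this)⟩
      (fun i => by rw [Function.iterate_add_apply, Function.iterate_minimalPeriod])
      (fun i hi => by
        have := (hε _ (hsrc i)).1 hi
        rwa [hsign, sign_nonneg_iff] at this)
      (fun i hi => by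
        have := (hε _ (hsrc i)).2 hi
        rwa [hsign, sign_nonpos_iff] at this)
    -- One period of the rotation runs through all oriented edges at the vertex, so changes at edges
    -- are images of changes at indices.
    refine le_trans (le_trans (Finset.card_le_card ?_)
      (Finset.card_image_le (f := fun i => T.σ^[i] e.dart))) hcount
    intro d hd
    simp only [Finset.mem_filter, Finset.mem_univ, true_and] at hd
    have hc : T.σ.SameCycle e.dart d := Quotient.exact hd.1.symm
    obtain ⟨j, hj⟩ := hc.exists_nat_pow_eq
    rw [← Equiv.Perm.iterate_eq_pow, ← Function.iterate_mod_minimalPeriod_eq] at hj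
    refine Finset.mem_image.mpr ⟨_, Finset.mem_filter.mpr ⟨Finset.mem_range.mpr
      (Nat.mod_lt j (minimalPeriod_pos e.dart)), ?_⟩, hj⟩
    simp only [Function.iterate_succ_apply', hj]
    exact hd.2

/-- A traceless matrix whose field and whose multiple by `i` are tangent to the circle of a vertex
at the tangency points is zero. -/
theorem eq_zero_of_outwardRate_eq_zero [Finite D] (hS : T.InPackingLocus ρ S) (α : T.UVert x₀)
    {A : Matrix (Fin 2) (Fin 2) ℂ} (htr : A.trace = 0)
    (h : ∀ (e : T.UDart x₀) (z : Fin 2 → ℂ), e.src = α → z ≠ 0 →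
      ((S e.src : Matrix (Fin 2) (Fin 2) ℂ) + (S e.tgt : Matrix (Fin 2) (Fin 2) ℂ)) *ᵥ
        star z = 0 →
        outwardRate (S α) A z = 0 ∧ outwardRate (S α) (Complex.I • A) z = 0) : A = 0 := by
  obtain ⟨d, hd⟩ := Quotient.exists_rep α.1
  let e : T.UDart x₀ := ⟨α, d, hd⟩
  obtain ⟨B, θ, z, hθ, hper, hz, htrig⟩ := hS.exists_tangency_data e
  have hrate : ∀ i, outwardRate (S e.src) A (z i) = 0 ∧
      outwardRate (S e.src) (Complex.I • A) (z i) = 0 := fun i =>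
    h (UDart.rot^[i] e) (z i) (UDart.src_rot_iterate e i) (hz i).1 (by
      rw [UDart.src_rot_iterate]
      exact (hz i).2)
  have htr' : (Complex.I • A).trace = 0 := by rw [Matrix.trace_smul, htr, smul_zero]
  have h20 : θ 2 < θ 0 + 2 * Real.pi := by
    rw [← hper, zero_add]
    exact hθ (two_lt_minimalPeriod _)
  have hzero : ∀ {a b c : ℝ}, (∀ i, trigLinear a b c (θ i) = 0) → a = 0 ∧ b = 0 ∧ c = 0 :=
    fun h => trigLinear_eq_zero_of_three_zeros (hθ zero_lt_one) (hθ one_lt_two) h20 (h 0) (h 1) (h 2)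
  -- For the conjugated matrix N, the field of A yields the vanishing of Re N₀₀, Re (N₀₁ - N₁₀) and
  -- Im (N₀₁ + N₁₀); the field of iA yields the three complementary real equations.
  obtain ⟨a1, b1, c1⟩ := hzero fun i => (htrig A htr i).symm.trans (hrate i).1
  obtain ⟨a2, b2, c2⟩ := hzero fun i => (htrig _ htr' i).symm.trans (hrate i).2
  have hBB : ((B⁻¹ : SL(2, ℂ)) : Matrix (Fin 2) (Fin 2) ℂ) * B = 1 := by
    rw [← Matrix.SpecialLinearGroup.coe_mul]; simp
  have hadj : ∀ N, adjAct (QuotientGroup.mk B) N = (B : Matrix (Fin 2) (Fin 2) ℂ) * N *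
      ((B⁻¹ : SL(2, ℂ)) : Matrix (Fin 2) (Fin 2) ℂ) := fun N => rfl
  simp only [hadj, Matrix.mul_smul, Matrix.smul_mul, Matrix.smul_apply, smul_eq_mul,
    Complex.I_mul_re, Complex.I_mul_im] at a1 b1 c1 a2 b2 c2
  have htrA : ((B : Matrix (Fin 2) (Fin 2) ℂ) * A *
      ((B⁻¹ : SL(2, ℂ)) : Matrix (Fin 2) (Fin 2) ℂ)).trace = 0 := by
    rw [Matrix.trace_mul_comm, ← Matrix.mul_assoc, hBB, Matrix.one_mul, htr]
  set N := (B : Matrix (Fin 2) (Fin 2) ℂ) * A *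
    ((B⁻¹ : SL(2, ℂ)) : Matrix (Fin 2) (Fin 2) ℂ) with hN
  have h00 : N 0 0 = 0 := Complex.ext (by simp; linarith) (by simp; linarith)
  have h01 : N 0 1 = 0 := Complex.ext (by simp; linarith) (by simp; linarith)
  have h10 : N 1 0 = 0 := Complex.ext (by simp; linarith) (by simp; linarith)
  have h11 : N 1 1 = 0 := by
    rw [Matrix.trace_fin_two, h00, zero_add] at htrA
    exact htrA
  have hN0 : N = 0 := by
    ext i j
    fin_cases i <;> fin_cases j <;> assumption
  calc A = ((B⁻¹ : SL(2, ℂ)) : Matrix (Fin 2) (Fin 2) ℂ) * N * B := by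
        rw [hN, Matrix.mul_assoc, Matrix.mul_assoc, Matrix.mul_assoc, hBB, Matrix.mul_one,
          ← Matrix.mul_assoc, hBB, Matrix.one_mul]
    _ = 0 := by rw [hN0, Matrix.mul_zero, Matrix.zero_mul]

end InPackingLocus

end OrientedTriangulation
-- Infinitesimal rigidity
theorem theorem5p1 {D : Type*} [Finite D] (T : OrientedTriangulation D)
    (g : ℕ) (hg : 2 ≤ g) (hχ : T.eulerChar = 2 - 2 * (g : ℤ))
    (x₀ : T.Vert) (hT : T.QuasiSimplicial x₀)
    (ρ : T.FundGroup x₀ →* PSL(2, ℂ)) (S : T.UVert x₀ → deSitter)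
    (hρS : T.InPackingLocus ρ S)
    (P : T.UVert x₀ → LieAlgebra.SpecialLinear.sl (Fin 2) ℂ)
    (hP : ∀ (γ : T.FundGroup x₀) (α : T.UVert x₀),
      (P (γ • α) : Matrix (Fin 2) (Fin 2) ℂ) = adjAct (ρ γ) (P α))
    (hv : ∀ (e : T.UDart x₀) (p : CP1), IsTangencyPoint (S e.src) (S e.tgt) p →
      SameVelocityAt (P e.tgt) (P e.src) p) :
    P = 0 := by
  have hχ' : T.eulerChar < 0 := by omega
  have htr : ∀ α, (P α : Matrix (Fin 2) (Fin 2) ℂ).trace = 0 := fun α =>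
    LinearMap.mem_ker.mp (P α).2
  have hrate := fun e z => hρS.outwardRate_eq_zero (z := z)
    (P := fun α => (P α : Matrix (Fin 2) (Fin 2) ℂ)) hχ' hT htr hP
    (fun e p hp => (hv e p hp).wedge_eq) e
  -- Equivariance and equality of the fields at tangency points are complex linear conditions, so
  -- they pass to iP.
  have hrate' := fun e z => hρS.outwardRate_eq_zero (z := z)
    (P := fun α => Complex.I • (P α : Matrix (Fin 2) (Fin 2) ℂ)) hχ' hT
    (fun α => by rw [Matrix.trace_smul, htr, smul_zero])
    (fun γ α => by
      rw [hP]
      induction ρ γ using QuotientGroup.induction_on with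
      | H B =>
      change _ • (_ * _ * _) = _ * _ * _
      rw [Matrix.mul_smul, Matrix.smul_mul])
    (fun e p hp => by
      simp only [Matrix.smul_mulVec, Pi.smul_apply, smul_eq_mul]
      linear_combination Complex.I * (hv e p hp).wedge_eq) e
  funext α
  refine Subtype.ext (hρS.eq_zero_of_outwardRate_eq_zero α (htr α) ?_)
  rintro e z rfl hz hKz
  exact ⟨hrate e z hz hKz, hrate' e z hz hKz⟩
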